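/- **Setting.** Let $\mathcal Y=\mathbb R^n$ carry an arbitrary norm $\|\cdot\|$ with dual norm $\|\cdot\|_*$, let $\hat y_1,\dots,\hat y_N\in\mathcal Y$, and let $\mathcal A\subseteq\mathbb R^n$ be a set of decisions. Let $\mathcal V\subseteq\mathbb R^N\times\mathbb R$ be a convex set of pairs $(p,\delta)$ with $p_i\ge 0$ and $\sum_{i=1}^N p_i=1$; put $\mathcal V_+=\{(p,\delta)\in\mathcal V:\delta\ge 0\}$ and $\sigma^*(v\mid\mathcal V_+)=\sup_{(p,\delta)\in\mathcal V_+}\big(\sum_{i=1}^N v_ip_i+v_{N+1}\delta\big)$ for $v\in\mathbb R^{N+1}$. For $q\in[1,\infty)$ let $\mathcal W_{(q)}(\mathbb Q,\mathbb P)=\inf_\pi\mathbb E_\pi\|\xi_1-\xi_2\|^q$ over all couplings $\pi$ of $\mathbb Q$ and $\mathbb P$, and let $\mathbb B^{(q)}_\delta(\mathbb P)$ be the set of probability distributions $\mathbb Q$ on $\mathcal Y$ with $\mathcal W_{(q)}(\mathbb Q,\mathbb P)\le\delta$ (empty if $\delta<0$). For $\ell:\mathbb R\times\mathbb R\to[0,\infty)$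 let $\rho_{\mathbb Q}(Z)=\inf_{t\in\mathbb R}\{t+(\mathbb E_{\mathbb Q}[\ell(Z,t)^q])^{1/q}\}$, and for $\alpha\in\mathbb R^n$ let $$R_q(\alpha)=\sup\Big\{\rho_{\mathbb Q}(Y^\top\alpha)\;:\;\mathbb Q\in\bigcup_{(p,\delta)\in\mathcal V}\mathbb B^{(q)}_\delta\Big(\sum_{i=1}^N p_i\,\mathrm I_{\hat y_i}\Big)\Big\},$$ where $Y\sim\mathbb Q$ and $\mathrm I_y$ is the point mass at $y$. The union-ball problem is $\inf_{\alpha\in\mathcal A}R_q(\alpha)$. All values lie in $[-\infty,+\infty]$, with $\sup\emptyset=-\infty$, $\inf\emptyset=+\infty$, and $-\infty+\infty=-\infty$ in the objectives below (this only matters if $\mathcal V_+=\emptyset$). **(i)** Let $q=1$. Suppose that $\ell$ is nonnegative, jointly convex on $\mathbb R^2$, that $\ell(\cdot,t)$ is Lipschitz with a constant that does not depend on $t$, and that $\{t:t+\ell(z,t)\le a\}$ is bounded for all $z,a\in\mathbb R$. Let $\operatorname{Lip}(\ell)$ be the least uniform Lipschitz constant in $z$. Then $$\inf_{\alpha\in\mathcal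 A}R_1(\alpha)=\inf_{\alpha\in\mathcal A,\,t\in\mathbb R}\ \sup_{(p,\delta)\in\mathcal V_+}\Big\{t+\sum_{i=1}^N p_i\,\ell(\hat y_i^\top\alpha,t)+\operatorname{Lip}(\ell)\,\delta\,\|\alpha\|_*\Big\},$$ and this equals the value of $$\inf_{\alpha\in\mathcal A,\,t\in\mathbb R,\,v\in\mathbb R^{N+1}} t+\sigma^*(v\mid\mathcal V_+)\quad\text{s.t.}\quad v_i\ge\ell(\hat y_i^\top\alpha,t)\ (i=1,\dots,N),\quad v_{N+1}\ge\operatorname{Lip}(\ell)\|\alpha\|_*.$$ **(ii)** Let $q\in(1,\infty)$ and $C>1$. Suppose that $\ell(z,t)=C\,\bar\ell(z-t)$ with $\bar\ell$ one of (a) $\bar\ell(x)=(x-b)_+$ with $b\in\mathbb R$; (b) $\bar\ell(x)=(|x-b_1|-b_2)_+$ with $b_1\in\mathbb R$, $b_2\ge 0$; (c) $\bar\ell(x)=|x-b_1|+b_2$ with $b_1\in\mathbb R$, $b_2>0$; or that $\ell(z,t)=C(|z|-t)_+$. Then $$\inf_{\alpha\in\mathcal A}R_q(\alpha)=\inf_{\alpha\in\mathcal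 A,\,t\in\mathbb R}\ \sup_{(p,\delta)\in\mathcal V_+}\Big\{t+\Big(\sum_{i=1}^N p_i\,\ell(\hat y_i^\top\alpha,t)^q\Big)^{1/q}+C\,\delta^{1/q}\,\|\alpha\|_*\Big\},$$ and this equals the value of $$\inf_{\alpha\in\mathcal A,\,t\in\mathbb R,\,y\ge 0,\,v\in\mathbb R^{N+1}} t+\sigma^*(v\mid\mathcal V_+)+C_q^1\,y+C_q\,v_{N+1}\Big\|\frac{\alpha}{v_{N+1}}\Big\|_*^{\frac q{q-1}}\quad\text{s.t.}\quad v_i\ge\frac{\ell(\hat y_i^\top\alpha,t)^q}{y^{q-1}}\ (i=1,\dots,N),\quad v_{N+1}\ge 0,$$ where $C_q^1=q^{\frac1{1-q}}-q^{\frac q{1-q}}$ and $C_q=C^{\frac q{q-1}}C_q^1$. Here, at $y=0$, $a/y^{q-1}$ is read as $0$ if $a=0$ and $+\infty$ if $a>0$; at $v_{N+1}=0$, $v_{N+1}\|\alpha/v_{N+1}\|_*^{q/(q-1)}$ is read as $0$ if $\alpha=0$ and $+\infty$ otherwise. In both parts the two equalities also hold for each fixed $\alpha\in\mathcal A$ (infima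 taken over the remaining variables only), and if $\mathcal A$ is convex, then the last program is a convex program: its feasible set is convex and its objective is convex on it. -/

import Mathlib

open MeasureTheory
open scoped ENNReal NNReal

noncomputable section

/-- Couplings of two measures on `E`. -/
def couplings {E : Type*} [MeasurableSpace E] (μ ν : Measure E) : Set (Measure (E × E)) :=
  {π | π.map Prod.fst = μ ∧ π.map Prod.snd = ν}

/-- Optimal transport cost for the ground cost `‖y₁ - y₂‖ ^ q`. -/
def transportCost {E : Type*} [NormedAddCommGroup E] [MeasurableSpace E] (q : ℝ)
    (μ ν : Measure E) : ℝ≥0∞ :=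
  ⨅ π ∈ couplings μ ν, ∫⁻ z, ENNReal.ofReal (‖z.1 - z.2‖ ^ q) ∂π

/-- Optimal transport ball of (real) radius `δ` around `P`; it is empty when `δ < 0`. -/
def otBall {E : Type*} [NormedAddCommGroup E] [MeasurableSpace E] (q δ : ℝ) (P : Measure E) :
    Set (Measure E) :=
  {Q | IsProbabilityMeasure Q ∧ ((transportCost q Q P : ℝ≥0∞) : EReal) ≤ (δ : EReal)}

/-- The discrete distribution `∑ i, p i • δ_{ŷ i}`. -/
def discreteLaw {E : Type*} [MeasurableSpace E] {N : ℕ} (yhat : Fin N → E) (p : Fin N → ℝ) :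
    Measure E :=
  ∑ i, ENNReal.ofReal (p i) • Measure.dirac (yhat i)

/-- The union of the balls over all admissible pairs `(p, δ) ∈ V`. -/
def unionBall {E : Type*} [NormedAddCommGroup E] [MeasurableSpace E] {N : ℕ} (q : ℝ)
    (yhat : Fin N → E) (V : Set ((Fin N → ℝ) × ℝ)) : Set (Measure E) :=
  ⋃ x ∈ V, otBall q x.2 (discreteLaw yhat x.1)

/-- The risk functional `inf_t { t + (𝔼[ℓ(Z, t) ^ q]) ^ (1/q) }` for a loss `ℓ ≥ 0`; the
expectation of the nonnegative random variable is a Lebesgue integral with values in `[0, ∞]`. -/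
def rhoTwo {Ω : Type*} [MeasurableSpace Ω] (q : ℝ) (loss : ℝ → ℝ → ℝ) (Q : Measure Ω)
    (Z : Ω → ℝ) : EReal :=
  ⨅ t : ℝ, (t : EReal) +
    (((∫⁻ ω, ENNReal.ofReal (loss (Z ω) t ^ q) ∂Q) ^ (1 / q) : ℝ≥0∞) : EReal)

/-- Worst-case risk of the decision `α` over the union of balls. Decisions are elements of the
dual space, so that `α y` is `yᵀα` and `‖α‖` is the dual norm. -/
def worstCaseRisk {E : Type*} [NormedAddCommGroup E] [NormedSpace ℝ E] [MeasurableSpace E] {N : ℕ}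
    (q : ℝ) (loss : ℝ → ℝ → ℝ) (yhat : Fin N → E) (V : Set ((Fin N → ℝ) × ℝ))
    (α : StrongDual ℝ E) : EReal :=
  ⨆ Q ∈ unionBall q yhat V, rhoTwo q loss Q (fun y => α y)

/-- `V₊ = {(p, δ) ∈ V : δ ≥ 0}`. -/
def nonnegRadius {N : ℕ} (V : Set ((Fin N → ℝ) × ℝ)) : Set ((Fin N → ℝ) × ℝ) :=
  {x | x ∈ V ∧ 0 ≤ x.2}

/-- Convex conjugate of the indicator function of `S`, i.e. `sup_{x ∈ S} vᵀx`. -/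
def indicatorConjugate {N : ℕ} (S : Set ((Fin N → ℝ) × ℝ)) (v : (Fin N → ℝ) × ℝ) : EReal :=
  ⨆ x ∈ S, ((∑ i, v.1 i * x.1 i + v.2 * x.2 : ℝ) : EReal)

/-- Minimizing `obj` over `feas` is a convex program: the feasible set is convex and the
extended-real-valued objective is convex on it (its epigraph is convex). -/
def IsConvexProgram {X : Type*} [AddCommGroup X] [Module ℝ X] (feas : Set X) (obj : X → EReal) :
    Prop :=
  Convex ℝ feas ∧ Convex ℝ {z : X × ℝ | z.1 ∈ feas ∧ obj z.1 ≤ (z.2 : EReal)}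

section OrderOne

variable {E : Type*} [NormedAddCommGroup E] [NormedSpace ℝ E] {N : ℕ}

/-- `sup_{(p,δ) ∈ V₊} t + ∑ p_i ℓ(ŷ_iᵀα, t) + L δ ‖α‖_*`. -/
def robustObjOne (loss : ℝ → ℝ → ℝ) (L : ℝ) (yhat : Fin N → E) (V : Set ((Fin N → ℝ) × ℝ))
    (α : StrongDual ℝ E) (t : ℝ) : EReal :=
  ⨆ x ∈ nonnegRadius V, ((t + ∑ i, x.1 i * loss (α (yhat i)) t + L * x.2 * ‖α‖ : ℝ) : EReal)

/-- Feasible points `(α, t, (v₁, …, v_N), v_{N+1})` of the program for transport order one. -/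
def feasOne (A : Set (StrongDual ℝ E)) (loss : ℝ → ℝ → ℝ) (L : ℝ) (yhat : Fin N → E) :
    Set (StrongDual ℝ E × ℝ × (Fin N → ℝ) × ℝ) :=
  {x | match x with
    | (α, t, v, w) => α ∈ A ∧ (∀ i, loss (α (yhat i)) t ≤ v i) ∧ L * ‖α‖ ≤ w}

/-- Objective `t + σ*(v | V₊)`. -/
def objOne (V : Set ((Fin N → ℝ) × ℝ)) :
    StrongDual ℝ E × ℝ × (Fin N → ℝ) × ℝ → EReal :=
  fun (_, t, v, w) => (t : EReal) + indicatorConjugate (nonnegRadius V) (v, w)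

end OrderOne

section OrderQ

/-- `a / y ^ (q - 1)` for `a, y ≥ 0`, with the values `0 / 0 = 0` and `a / 0 = ∞` for `a > 0`. -/
def quotPow (q a y : ℝ) : EReal :=
  if y = 0 then (if a = 0 then 0 else ⊤) else ((a / y ^ (q - 1) : ℝ) : EReal)

/-- `w ‖α / w‖ ^ r` for `w ≥ 0`, with the values `0` at `w = 0, α = 0` and `∞` at `w = 0, α ≠ 0`. -/
def perspNormPow {F : Type*} [NormedAddCommGroup F] [NormedSpace ℝ F] (r : ℝ) (α : F) (w : ℝ) :
    EReal :=
  open Classical in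
  if w = 0 then (if α = 0 then 0 else ⊤) else ((w * ‖w⁻¹ • α‖ ^ r : ℝ) : EReal)

/-- The losses of part (ii): `C ℓ̄(z - t)` with `ℓ̄(x)` equal to `(x - b)₊`, to `(|x - b₁| - b₂)₊`
with `b₂ ≥ 0`, or to `|x - b₁| + b₂` with `b₂ > 0`; or `C (|z| - t)₊`. -/
def IsSpecialLoss (C : ℝ) (loss : ℝ → ℝ → ℝ) : Prop :=
  (∃ b : ℝ, ∀ z t, loss z t = C * max ((z - t) - b) 0) ∨
  (∃ b₁ b₂ : ℝ, 0 ≤ b₂ ∧ ∀ z t, loss z t = C * max (|(z - t) - b₁| - b₂) 0) ∨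
  (∃ b₁ b₂ : ℝ, 0 < b₂ ∧ ∀ z t, loss z t = C * (|(z - t) - b₁| + b₂)) ∨
  (∀ z t, loss z t = C * max (|z| - t) 0)

/-- `C_q¹ = q^{1/(1-q)} - q^{q/(1-q)}`. -/
def constQOne (q : ℝ) : ℝ := q ^ (1 / (1 - q)) - q ^ (q / (1 - q))

/-- `C_q = C^{q/(q-1)} (q^{1/(1-q)} - q^{q/(1-q)})`. -/
def constQ (q C : ℝ) : ℝ := C ^ (q / (q - 1)) * (q ^ (1 / (1 - q)) - q ^ (q / (1 - q)))

variable {E : Type*} [NormedAddCommGroup E] [NormedSpace ℝ E] {N : ℕ}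

/-- `sup_{(p,δ) ∈ V₊} t + (∑ p_i ℓ(ŷ_iᵀα, t)^q)^{1/q} + C δ^{1/q} ‖α‖_*`. -/
def robustObjQ (q : ℝ) (loss : ℝ → ℝ → ℝ) (C : ℝ) (yhat : Fin N → E)
    (V : Set ((Fin N → ℝ) × ℝ)) (α : StrongDual ℝ E) (t : ℝ) : EReal :=
  ⨆ x ∈ nonnegRadius V,
    ((t + (∑ i, x.1 i * loss (α (yhat i)) t ^ q) ^ (1 / q) + C * x.2 ^ (1 / q) * ‖α‖ : ℝ) : EReal)

/-- Feasible points `(α, t, y, (v₁, …, v_N), v_{N+1})` of the program for transport order `q`. -/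
def feasQ (A : Set (StrongDual ℝ E)) (q : ℝ) (loss : ℝ → ℝ → ℝ) (yhat : Fin N → E) :
    Set (StrongDual ℝ E × ℝ × ℝ × (Fin N → ℝ) × ℝ) :=
  {x | match x with
    | (α, t, y, v, w) => α ∈ A ∧ 0 ≤ y ∧
        (∀ i, quotPow q (loss (α (yhat i)) t ^ q) y ≤ ((v i : ℝ) : EReal)) ∧ 0 ≤ w}

/-- Objective `t + σ*(v | V₊) + C_q¹ y + C_q v_{N+1} ‖α / v_{N+1}‖_* ^ (q/(q-1))`. -/
def objQ (q C : ℝ) (V : Set ((Fin N → ℝ) × ℝ)) :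
    StrongDual ℝ E × ℝ × ℝ × (Fin N → ℝ) × ℝ → EReal :=
  fun (α, t, y, v, w) => (t : EReal) + indicatorConjugate (nonnegRadius V) (v, w)
    + ((constQOne q * y : ℝ) : EReal) + (constQ q C : EReal) * perspNormPow (q / (q - 1)) α w

end OrderQ

end

/-! ### Minimax by separation and compactness -/

section Minimax

/-! Fix `α`. For the upper bound on the risk, a coupling and Minkowski's inequality in `L^q` bound
the loss of any `Q` in a ball of radius `δ` by its value at the discrete law plus `L δ^(1/q) ‖α‖`
(`lintegral_rpow_le_of_mem_otBall`); then `sup inf ≤ inf sup`.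

For the lower bound, only finitely supported plans moving atoms along a direction that attains the
dual norm are needed. In terms of plans the constraints are linear, the expectation is linear, and
the power `1/q` is concave, so the risk is concave in the plan and convex in `t`; the boundedness of
the sets `{t + ℓ ≤ a}` supplies compactness, and a Ky Fan minimax (`exists_plan_forall_le`)
exchanges the two. It remains to beat every value below the bound for each single `t`, which is the
property `Reaches`. For `q = 1` a vanishing fraction of mass sent to infinity collects the
asymptotic slope, and joint convexity makes this slope available in one direction for all `t`. For
`q > 1` escaping mass is not enough when the current loss is positive. The special losses have slope
exactly `C` wherever they are positive, so shifting each atom in proportion to its loss gives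
equality in Minkowski.

The convex program for `q = 1` is an epigraph form. For `q > 1` each root is written as `s^(1/q) =
inf_y (s / y^(q-1) + C_q¹ y)`, the equality case of Young's inequality; a second use of the minimax
theorem moves the infima over the auxiliary variables outside the supremum over `V₊`
(`exists_forall_div_rpow_add_le`). Convexity of the program rests on the joint convexity of `g^q /
y^(q-1)`, which also describes the perspective of the norm power. -/

/-- A finite family of convex functions whose maximum exceeds `c` has a convex combination that is
at least `c`. -/
theorem exists_stdSimplex_forall_le_sum {ι T : Type*} [Fintype ι] [AddCommGroup T] [Module ℝ T]
    {D : Set T} (hD : D.Nonempty) {f : ι → T → ℝ} {c : ℝ} (hf : ∀ j, ConvexOn ℝ D (f j))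
    (h : ∀ t ∈ D, ∃ j, c < f j t) :
    ∃ w ∈ stdSimplex ℝ ι, ∀ t ∈ D, c ≤ ∑ j, w j * f j t := by
  classical
  set G : Set (ι → ℝ) := {r | ∃ t ∈ D, ∀ j, f j t ≤ r j} with hG
  set O : Set (ι → ℝ) := {r | ∀ j, r j < c} with hO
  have hGc : Convex ℝ G := by
    rintro r ⟨t, ht, htr⟩ r' ⟨t', ht', htr'⟩ a b ha hb hab
    refine ⟨a • t + b • t', (hf (h t ht).choose).1 ht ht' ha hb hab, fun j => ?_⟩
    refine ((hf j).2 ht ht' ha hb hab).trans ?_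
    simp only [smul_eq_mul, Pi.add_apply, Pi.smul_apply]
    gcongr
    · exact htr j
    · exact htr' j
  have hOeq : O = Set.pi Set.univ fun _ => Set.Iio c := by ext; simp [hO]
  have hOc : Convex ℝ O := by rw [hOeq]; exact convex_pi fun _ _ => convex_Iio c
  have hOo : IsOpen O := by
    rw [hOeq]; exact isOpen_set_pi Set.finite_univ fun _ _ => isOpen_Iio
  have hdisj : Disjoint O G := by
    rw [Set.disjoint_left]
    rintro r hr ⟨t, ht, htr⟩
    obtain ⟨j, hj⟩ := h t ht
    exact absurd ((htr j).trans_lt (hr j)) hj.not_gt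
  obtain ⟨φ, u, hφO, hφG⟩ := geometric_hahn_banach_open hOc hOo hGc hdisj
  set e : ι → ℝ := fun j => φ (Pi.single j 1) with he
  have hφ : ∀ r, φ r = ∑ j, e j * r j := by
    intro r
    conv_lhs => rw [← Finset.univ_sum_single r, map_sum]
    refine Finset.sum_congr rfl fun j _ => ?_
    have : Pi.single j (r j) = r j • (Pi.single j 1 : ι → ℝ) := by
      rw [← Pi.single_smul]; simp
    rw [this, map_smul, smul_eq_mul, mul_comm]
  obtain ⟨t₀, ht₀⟩ := hD
  -- `G` is closed upwards, so a negative coefficient would make `φ` unbounded below on `G`; `s` is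
  -- chosen so that `φ` takes the value `u - 1`.
  have he0 : ∀ j, 0 ≤ e j := by
    intro j
    by_contra! hj
    set s : ℝ := (φ (fun i => f i t₀) - u + 1) / (- e j) with hs
    have hu : u ≤ φ (fun i => f i t₀) := hφG _ ⟨t₀, ht₀, fun _ => le_rfl⟩
    have hs0 : 0 ≤ s := div_nonneg (by linarith) (by linarith)
    have := hφG ((fun i => f i t₀) + s • Pi.single j 1) ⟨t₀, ht₀, fun i => by
      have : 0 ≤ (Pi.single j 1 : ι → ℝ) i := by
        by_cases hij : i = j
        · subst hij; simp
        · simp [hij]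
      simpa using mul_nonneg hs0 this⟩
    rw [map_add, map_smul, smul_eq_mul] at this
    have h2 : s * e j = -(φ (fun i => f i t₀) - u + 1) := by
      have := hj.ne
      rw [hs]; field_simp
    change u ≤ _ + s * e j at this
    linarith
  have hO' : ∀ b < c, b * ∑ j, e j < u := by
    intro b hb
    have := hφO (fun _ => b) fun _ => hb
    rw [hφ, ← Finset.sum_mul] at this
    linarith
  have hcu : c * ∑ j, e j ≤ u := by
    by_contra! hlt
    have h1 := hO' (c - 1) (by linarith)
    have hE : 0 < ∑ j, e j := by
      by_contra! hle
      nlinarith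
    have := hO' (u / ∑ j, e j) ((div_lt_iff₀ hE).2 hlt)
    rw [div_mul_cancel₀ _ hE.ne'] at this
    exact lt_irrefl _ this
  -- If all coefficients vanished, `φ` would be zero and could not separate strictly.
  have hE : 0 < ∑ j, e j := by
    refine lt_of_le_of_ne (Finset.sum_nonneg fun j _ => he0 j) fun h0 => ?_
    have hz : ∀ j, e j = 0 := fun j =>
      (Finset.sum_eq_zero_iff_of_nonneg fun j _ => he0 j).1 h0.symm j (Finset.mem_univ j)
    have h1 := hO' (c - 1) (by linarith)
    have h2 := hφG _ ⟨t₀, ht₀, fun _ => le_rfl⟩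
    rw [hφ] at h2
    simp only [hz, zero_mul, Finset.sum_const_zero, mul_zero] at h1 h2
    linarith
  refine ⟨fun j => e j / ∑ j, e j, ⟨fun j => div_nonneg (he0 j) hE.le, ?_⟩, fun t ht => ?_⟩
  · rw [← Finset.sum_div, div_self hE.ne']
  · have h2 := hφG _ ⟨t, ht, fun _ => le_rfl⟩
    rw [hφ] at h2
    simp only [div_mul_eq_mul_div]
    rw [← Finset.sum_div, le_div_iff₀ hE]
    linarith

/-- A minimax theorem of Ky Fan type: `f` is concave in the first and convex and continuous in the
second variable, and one sublevel set is compact. -/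
theorem exists_forall_le_of_concaveOn_convexOn {X T : Type*} [AddCommGroup X] [Module ℝ X]
    [AddCommGroup T] [Module ℝ T] [TopologicalSpace T] {S : Set X} {D : Set T} {f : X → T → ℝ}
    {c : ℝ} (hconv : ∀ x ∈ S, ConvexOn ℝ D (f x)) (hcont : ∀ x ∈ S, ContinuousOn (f x) D)
    (hconc : ∀ t ∈ D, ConcaveOn ℝ S fun x => f x t) {x₀ : X} (hx₀ : x₀ ∈ S)
    (hK : IsCompact {t ∈ D | f x₀ t ≤ c}) (h : ∀ t ∈ D, ∃ x ∈ S, c < f x t) :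
    ∃ x ∈ S, ∀ t ∈ D, c ≤ f x t := by
  classical
  rcases D.eq_empty_or_nonempty with rfl | hD
  · exact ⟨x₀, hx₀, by simp⟩
  choose! g hgS hg using h
  obtain ⟨F, hFK, hF⟩ := hK.elim_nhdsWithin_subcover (fun t => {s | c < f (g t) s}) fun t ht =>
    nhdsWithin_mono t (Set.sep_subset _ _)
      (((hcont _ (hgS t ht.1)) t ht.1).eventually (lt_mem_nhds (hg t ht.1)))
  -- The images under `g` exceed `c` on the compact sublevel set of `x₀`, and `x₀` itself exceeds
  -- `c` off it, so the finite family works on all of `D`.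
  set I : Finset X := insert x₀ (F.image g) with hI
  have hIS : ∀ x ∈ I, x ∈ S := by
    intro x hx
    rcases Finset.mem_insert.1 hx with rfl | hx
    · exact hx₀
    · obtain ⟨t, ht, rfl⟩ := Finset.mem_image.1 hx
      exact hgS t (hFK t ht).1
  obtain ⟨w, hw, hle⟩ := exists_stdSimplex_forall_le_sum (ι := I) (c := c) hD
    (f := fun j => f j) (fun j => hconv j (hIS j j.2)) fun t ht => by
      by_cases htc : f x₀ t ≤ c
      · have := hF ⟨ht, htc⟩
        simp only [Set.mem_iUnion, Set.mem_ofPred_eq, exists_prop] at this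
        obtain ⟨s, hs, hlt⟩ := this
        exact ⟨⟨g s, Finset.mem_insert_of_mem (Finset.mem_image_of_mem g hs)⟩, hlt⟩
      · exact ⟨⟨x₀, Finset.mem_insert_self _ _⟩, not_le.1 htc⟩
  have hmem : ∀ j : I, (j : X) ∈ S := fun j => hIS j j.2
  obtain ⟨t₀, ht₀⟩ := hD
  refine ⟨∑ j : I, w j • (j : X), (hconc t₀ ht₀).1.sum_mem (fun j _ => hw.1 j) hw.2
    fun j _ => hmem j, fun t ht => (hle t ht).trans ?_⟩
  exact (hconc t ht).le_map_sum (fun j _ => hw.1 j) hw.2 fun j _ => hmem j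

end Minimax

/-! ### Finitely supported transport plans -/

section Plans

/-- Minkowski: a weighted `ℓ^q` norm of nonnegative convex functions is convex. -/
theorem convexOn_weighted_Lp {ι X : Type*} [AddCommGroup X] [Module ℝ X] (s : Finset ι) {q : ℝ}
    (hq : 1 ≤ q) {w : ι → ℝ} (hw : ∀ k ∈ s, 0 ≤ w k) {D : Set X} (hD : Convex ℝ D)
    {g : ι → X → ℝ} (hg : ∀ k ∈ s, ConvexOn ℝ D (g k)) (hg0 : ∀ k ∈ s, ∀ t ∈ D, 0 ≤ g k t) :
    ConvexOn ℝ D fun t => (∑ k ∈ s, w k * g k t ^ q) ^ (1 / q) := by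
  have hq0 : 0 < q := by linarith
  refine ⟨hD, fun t ht t' ht' a b ha hb hab => ?_⟩
  -- The weights are absorbed into the functions as `w k ^ (1 / q)`, which reduces the claim to the
  -- unweighted Minkowski inequality.
  have key : ∀ k ∈ s, ∀ τ ∈ D, ∀ a : ℝ, 0 ≤ a →
      (a * (w k ^ (1 / q) * g k τ)) ^ q = a ^ q * (w k * g k τ ^ q) := by
    intro k hk τ hτ a ha
    rw [Real.mul_rpow ha (mul_nonneg (Real.rpow_nonneg (hw k hk) _) (hg0 k hk τ hτ)),
      Real.mul_rpow (Real.rpow_nonneg (hw k hk) _) (hg0 k hk τ hτ), ← Real.rpow_mul (hw k hk),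
      one_div_mul_cancel hq0.ne', Real.rpow_one]
  have hpull : ∀ τ ∈ D, ∀ a : ℝ, 0 ≤ a →
      (∑ k ∈ s, (a * (w k ^ (1 / q) * g k τ)) ^ q) ^ (1 / q) =
        a * (∑ k ∈ s, w k * g k τ ^ q) ^ (1 / q) := by
    intro τ hτ a ha
    rw [Finset.sum_congr rfl fun k hk => key k hk τ hτ a ha, ← Finset.mul_sum,
      Real.mul_rpow (Real.rpow_nonneg ha _) (Finset.sum_nonneg fun k hk =>
        mul_nonneg (hw k hk) (Real.rpow_nonneg (hg0 k hk τ hτ) _)), ← Real.rpow_mul ha,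
      mul_one_div_cancel hq0.ne', Real.rpow_one]
  have hnn : ∀ k ∈ s, ∀ τ ∈ D, ∀ a : ℝ, 0 ≤ a → 0 ≤ a * (w k ^ (1 / q) * g k τ) :=
    fun k hk τ hτ a ha => mul_nonneg ha (mul_nonneg (Real.rpow_nonneg (hw k hk) _) (hg0 k hk τ hτ))
  simp only [smul_eq_mul]
  rw [← hpull t ht a ha, ← hpull t' ht' b hb]
  refine le_trans ?_ (Real.Lp_add_le_of_nonneg s hq (fun k hk => hnn k hk t ht a ha)
    fun k hk => hnn k hk t' ht' b hb)
  have hm := hD ht ht' ha hb hab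
  refine Real.rpow_le_rpow (Finset.sum_nonneg fun k hk =>
    mul_nonneg (hw k hk) (Real.rpow_nonneg (hg0 k hk _ hm) _)) (Finset.sum_le_sum fun k hk => ?_)
    (by positivity)
  have := key k hk _ hm 1 zero_le_one
  rw [one_mul, Real.one_rpow, one_mul] at this
  rw [← this]
  refine Real.rpow_le_rpow (mul_nonneg (Real.rpow_nonneg (hw k hk) _) (hg0 k hk _ hm)) ?_ hq0.le
  have h2 := mul_le_mul_of_nonneg_left ((hg k hk).2 ht ht' ha hb hab)
    (Real.rpow_nonneg (hw k hk) (1 / q))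
  simp only [smul_eq_mul] at h2
  linarith

theorem ConvexOn.partial_right {f : ℝ → ℝ → ℝ}
    (h : ConvexOn ℝ Set.univ fun x : ℝ × ℝ => f x.1 x.2) (z : ℝ) :
    ConvexOn ℝ Set.univ (f z) := by
  refine ⟨convex_univ, fun t _ t' _ a b ha hb hab => ?_⟩
  have := h.2 (Set.mem_univ (z, t)) (Set.mem_univ (z, t')) ha hb hab
  simpa [← add_mul, hab] using this

/-- Finitely supported transport plans: the mass `m (i, r)` is moved from the atom `i` by the
signed distance `r`; the initial law and the transport budget form an element of `V`. -/
noncomputable def planSet {N : ℕ} (q : ℝ) (V : Set ((Fin N → ℝ) × ℝ)) : Set ((Fin N × ℝ) →₀ ℝ) :=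
  {m | (∀ k, 0 ≤ m k) ∧ ∃ x ∈ V,
    Finsupp.linearCombination ℝ (fun k : Fin N × ℝ => (Pi.single k.1 1 : Fin N → ℝ)) m = x.1 ∧
    Finsupp.linearCombination ℝ (fun k : Fin N × ℝ => |k.2| ^ q) m ≤ x.2}

/-- The objective `t + 𝔼[ℓ(Z, t) ^ q] ^ (1 / q)` for the law of `Z` given by a transport plan. -/
noncomputable def planRisk {N : ℕ} (q : ℝ) (loss : ℝ → ℝ → ℝ) (a : Fin N → ℝ) (κ : ℝ)
    (m : (Fin N × ℝ) →₀ ℝ) (t : ℝ) : ℝ :=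
  t + (Finsupp.linearCombination ℝ (fun k : Fin N × ℝ => loss (a k.1 + κ * k.2) t ^ q) m) ^ (1 / q)

theorem Finsupp.linearCombination_nonneg {ι : Type*} {h : ι → ℝ} (hh : ∀ k, 0 ≤ h k)
    {m : ι →₀ ℝ} (hm : ∀ k, 0 ≤ m k) : 0 ≤ Finsupp.linearCombination ℝ h m := by
  rw [Finsupp.linearCombination_apply, Finsupp.sum]
  exact Finset.sum_nonneg fun k _ => mul_nonneg (hm k) (hh k)

variable {N : ℕ} {q : ℝ} {V : Set ((Fin N → ℝ) × ℝ)} {loss : ℝ → ℝ → ℝ} {a : Fin N → ℝ} {κ : ℝ}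

theorem convex_planSet (hV : Convex ℝ V) : Convex ℝ (planSet q V) := by
  rintro m ⟨hm, x, hx, hmx, hmc⟩ m' ⟨hm', x', hx', hmx', hmc'⟩ a b ha hb hab
  refine ⟨fun k => add_nonneg (mul_nonneg ha (hm k)) (mul_nonneg hb (hm' k)),
    a • x + b • x', hV hx hx' ha hb hab, ?_, ?_⟩
  · rw [map_add, map_smul, map_smul, hmx, hmx']; rfl
  · rw [map_add, map_smul, map_smul]
    simp only [smul_eq_mul, Prod.snd_add, Prod.smul_snd]
    gcongr

theorem sum_eq_one_of_mem_planSet (hVp : ∀ x ∈ V, x.1 ∈ stdSimplex ℝ (Fin N))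
    {m : (Fin N × ℝ) →₀ ℝ} (hm : m ∈ planSet q V) : ∑ k ∈ m.support, m k = 1 := by
  obtain ⟨-, x, hx, hmx, -⟩ := hm
  rw [← (hVp x hx).2, ← hmx]
  simp only [Finsupp.linearCombination_apply, Finsupp.sum, Finset.sum_apply, Pi.smul_apply,
    smul_eq_mul]
  rw [Finset.sum_comm]
  refine Finset.sum_congr rfl fun k _ => ?_
  rw [← Finset.mul_sum]
  simp

/-- The expectation is linear in the plan and the power `1/q` is concave. This is the gain from
working with plans. -/
theorem concaveOn_planRisk (hq : 1 ≤ q) (hl : ∀ z t, 0 ≤ loss z t) (hV : Convex ℝ V) (t : ℝ) :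
    ConcaveOn ℝ (planSet q V) fun m => planRisk q loss a κ m t := by
  refine ⟨convex_planSet hV, fun m hm m' hm' b c hb hc hbc => ?_⟩
  have hh : ∀ k : Fin N × ℝ, 0 ≤ loss (a k.1 + κ * k.2) t ^ q :=
    fun k => Real.rpow_nonneg (hl _ _) _
  have := (Real.concaveOn_rpow (p := 1 / q) (by positivity)
    (by rw [div_le_one (by linarith)]; exact hq)).2
    (Set.mem_Ici.2 (Finsupp.linearCombination_nonneg hh hm.1))
    (Set.mem_Ici.2 (Finsupp.linearCombination_nonneg hh hm'.1)) hb hc hbc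
  simp only [planRisk, map_add, map_smul]
  simp only [smul_eq_mul] at this ⊢
  have ht : t = b * t + c * t := by rw [← add_mul, hbc, one_mul]
  linarith

theorem convexOn_planRisk (hq : 1 ≤ q) (hl : ∀ z t, 0 ≤ loss z t)
    (hconv : ConvexOn ℝ Set.univ fun x : ℝ × ℝ => loss x.1 x.2) {m : (Fin N × ℝ) →₀ ℝ}
    (hm : ∀ k, 0 ≤ m k) : ConvexOn ℝ Set.univ (planRisk q loss a κ m) := by
  refine (convexOn_id convex_univ).add ?_
  simp only [Finsupp.linearCombination_apply, Finsupp.sum, smul_eq_mul]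
  exact convexOn_weighted_Lp _ hq (fun k _ => hm k) convex_univ
    (fun k _ => hconv.partial_right _) fun k _ t _ => hl _ _

/-- By the power mean inequality the risk is at least the average of `t + loss` over the support. If
it is at most `c`, then so is `t + loss` at some atom, and finitely many bounded sets have a bounded
union. -/
theorem isBounded_planRisk_le (hq : 1 ≤ q) (hl : ∀ z t, 0 ≤ loss z t)
    (hbdd : ∀ z c : ℝ, Bornology.IsBounded {t : ℝ | t + loss z t ≤ c})
    (hVp : ∀ x ∈ V, x.1 ∈ stdSimplex ℝ (Fin N)) {m : (Fin N × ℝ) →₀ ℝ} (hm : m ∈ planSet q V)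
    (c : ℝ) : Bornology.IsBounded {t | planRisk q loss a κ m t ≤ c} := by
  refine ((Bornology.isBounded_biUnion_finset m.support).2 fun k _ =>
    hbdd (a k.1 + κ * k.2) c).subset fun t ht => ?_
  have h1 := sum_eq_one_of_mem_planSet hVp hm
  by_contra hnot
  simp only [Set.mem_iUnion, not_exists, Set.mem_ofPred_eq, not_le] at hnot
  have h2 := Real.arith_mean_le_rpow_mean m.support m (fun k => loss (a k.1 + κ * k.2) t)
    (fun k _ => hm.1 k) h1 (fun k _ => hl _ _) hq
  have h3 : c < ∑ k ∈ m.support, m k * (t + loss (a k.1 + κ * k.2) t) := by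
    calc c = ∑ k ∈ m.support, m k * c := by rw [← Finset.sum_mul, h1, one_mul]
      _ < _ := by
        refine Finset.sum_lt_sum_of_nonempty ?_ fun k hk => ?_
        · by_contra he
          rw [Finset.not_nonempty_iff_eq_empty] at he
          rw [he] at h1
          simp at h1
        · exact mul_lt_mul_of_pos_left (hnot k hk)
            (lt_of_le_of_ne (hm.1 k) (Finsupp.mem_support_iff.1 hk).symm)
  simp only [mul_add, Finset.sum_add_distrib] at h3
  rw [← Finset.sum_mul, h1, one_mul] at h3
  have h4 : planRisk q loss a κ m t ≤ c := ht
  simp only [planRisk, Finsupp.linearCombination_apply, Finsupp.sum, smul_eq_mul] at h4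
  linarith

/-- Minimax for transport plans. -/
theorem exists_plan_forall_le (hq : 1 ≤ q) (hl : ∀ z t, 0 ≤ loss z t)
    (hconv : ConvexOn ℝ Set.univ fun x : ℝ × ℝ => loss x.1 x.2)
    (hbdd : ∀ z c : ℝ, Bornology.IsBounded {t : ℝ | t + loss z t ≤ c})
    (hV : Convex ℝ V) (hVp : ∀ x ∈ V, x.1 ∈ stdSimplex ℝ (Fin N)) {c : ℝ}
    (h : ∀ t, ∃ m ∈ planSet q V, c < planRisk q loss a κ m t) :
    ∃ m ∈ planSet q V, ∀ t, c ≤ planRisk q loss a κ m t := by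
  obtain ⟨m₀, hm₀, -⟩ := h 0
  have hcont : ∀ m ∈ planSet q V, ContinuousOn (planRisk q loss a κ m) Set.univ := fun m hm =>
    (convexOn_planRisk hq hl hconv hm.1).continuousOn isOpen_univ
  have hK : IsCompact {t ∈ Set.univ | planRisk q loss a κ m₀ t ≤ c} := by
    simp only [Set.mem_univ, true_and]
    refine Metric.isCompact_of_isClosed_isBounded ?_ (isBounded_planRisk_le hq hl hbdd hVp hm₀ c)
    exact isClosed_le (continuousOn_univ.1 (hcont m₀ hm₀)) continuous_const
  obtain ⟨m, hm, hmc⟩ := exists_forall_le_of_concaveOn_convexOn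
    (f := planRisk q loss a κ) (fun m hm => convexOn_planRisk hq hl hconv hm.1) hcont
    (fun t _ => concaveOn_planRisk hq hl hV t) hm₀ hK fun t _ => h t
  exact ⟨m, hm, fun t => hmc t trivial⟩

/-- A plan that moves the fraction `ε` of the mass of each atom `i` by `r i`. -/
theorem exists_plan_of_shift (hq : 1 ≤ q) {x : (Fin N → ℝ) × ℝ} (hx : x ∈ V)
    (hp : ∀ i, 0 ≤ x.1 i) {ε : ℝ} (hε : ε ∈ Set.Icc (0 : ℝ) 1) (r : Fin N → ℝ)
    (hr : ε * ∑ i, x.1 i * |r i| ^ q ≤ x.2) (t : ℝ) :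
    ∃ m ∈ planSet q V, planRisk q loss a κ m t =
      t + (∑ i, x.1 i * ((1 - ε) * loss (a i) t ^ q + ε * loss (a i + κ * r i) t ^ q)) ^ (1 / q) := by
  have hq0 : q ≠ 0 := by linarith
  -- A sum of point masses, so that the two masses add up correctly when `r i = 0`.
  set m : (Fin N × ℝ) →₀ ℝ := ∑ i, (Finsupp.single (i, (0 : ℝ)) (x.1 i * (1 - ε)) +
    Finsupp.single (i, r i) (x.1 i * ε)) with hm
  refine ⟨m, ⟨fun k => ?_, x, hx, ?_, ?_⟩, ?_⟩
  · rw [hm, Finsupp.finsetSum_apply]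
    refine Finset.sum_nonneg fun i _ => ?_
    have h1 : (0 : Fin N × ℝ →₀ ℝ) ≤ Finsupp.single (i, (0 : ℝ)) (x.1 i * (1 - ε)) :=
      Finsupp.single_nonneg.2 (mul_nonneg (hp i) (by linarith [hε.2]))
    have h2 : (0 : Fin N × ℝ →₀ ℝ) ≤ Finsupp.single (i, r i) (x.1 i * ε) :=
      Finsupp.single_nonneg.2 (mul_nonneg (hp i) hε.1)
    exact add_nonneg (h1 k) (h2 k)
  · simp only [hm, map_sum, map_add, Finsupp.linearCombination_single, ← add_smul]
    ext j
    simp [Finset.sum_apply, Pi.single_apply, ← mul_add]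
  · refine le_trans (le_of_eq ?_) hr
    simp only [hm, map_sum, map_add, Finsupp.linearCombination_single, smul_eq_mul, abs_zero,
      Real.zero_rpow hq0, Finset.mul_sum]
    exact Finset.sum_congr rfl fun i _ => by ring
  · simp only [planRisk, hm, map_sum, map_add, Finsupp.linearCombination_single, smul_eq_mul,
      mul_zero, add_zero]
    congr 2
    exact Finset.sum_congr rfl fun i _ => by ring

end Plans

/-! ### Attaining the bound for a fixed `t` -/

section Reach

variable {N : ℕ}

/-- A jointly convex function grows in one of the two horizontal directions at any rate below its
least uniform Lipschitz constant, from every base point. -/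
theorem exists_asymptotic_slope {loss : ℝ → ℝ → ℝ} {L : ℝ≥0}
    (hconv : ConvexOn ℝ Set.univ fun x : ℝ × ℝ => loss x.1 x.2)
    (hL : IsLeast {K : ℝ≥0 | ∀ t, LipschitzWith K fun z => loss z t} L) {L' : ℝ} (h0 : 0 ≤ L')
    (hL' : L' < L) :
    ∃ s : ℝ, (s = 1 ∨ s = -1) ∧ ∀ t z, ∃ K R₀ : ℝ, ∀ R ≥ R₀, L' * R + K ≤ loss (z + s * R) t := by
  obtain ⟨t', z', s, r, hs, hr, hlt⟩ : ∃ t' z' s r : ℝ, (s = 1 ∨ s = -1) ∧ 0 < r ∧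
      loss z' t' + L' * r < loss (z' + s * r) t' := by
    by_contra! hno
    have hlip : ∀ t, LipschitzWith ⟨L', h0⟩ fun z => loss z t := by
      refine fun t => LipschitzWith.of_le_add_mul _ fun x y => ?_
      rcases lt_trichotomy y x with hxy | rfl | hxy
      · have := hno t y 1 (x - y) (Or.inl rfl) (sub_pos.2 hxy)
        rw [Real.dist_eq, abs_of_pos (sub_pos.2 hxy)]
        change _ ≤ _ + L' * _
        simpa using this
      · simp
      · have := hno t y (-1) (y - x) (Or.inr rfl) (sub_pos.2 hxy)
        rw [dist_comm, Real.dist_eq, abs_of_pos (sub_pos.2 hxy)]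
        change _ ≤ _ + L' * _
        simpa using this
    exact absurd (hL.2 hlip) (not_le.2 (NNReal.coe_lt_coe.1 hL'))
  -- One chord at `t'` is steeper than `L'`, and by convexity this growth persists farther out. The
  -- point `(z' + s R/2, t')` is the midpoint of `(z + s R, t)` and the fixed point `(2z' - z, 2t' -
  -- t)`, so the rate carries over to every `(z, t)` with the same sign `s`.
  refine ⟨s, hs, fun t z => ⟨2 * loss z' t' - loss (2 * z' - z) (2 * t' - t), 2 * r,
    fun R hR => ?_⟩⟩
  have hR' : r ≤ R / 2 := by linarith
  have hRpos : 0 < R / 2 := by linarith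
  have h1 : loss z' t' + L' * (R / 2) ≤ loss (z' + s * (R / 2)) t' := by
    have hθ : r / (R / 2) ≤ 1 := (div_le_one hRpos).2 hR'
    have := hconv.2 (Set.mem_univ (z', t')) (Set.mem_univ (z' + s * (R / 2), t'))
      (sub_nonneg.2 hθ) (by positivity) (by ring : 1 - r / (R / 2) + r / (R / 2) = 1)
    simp only [Prod.smul_mk, Prod.mk_add_mk, smul_eq_mul] at this
    have e1 : (1 - r / (R / 2)) * z' + r / (R / 2) * (z' + s * (R / 2)) = z' + s * r := by
      rw [show (1 - r / (R / 2)) * z' + r / (R / 2) * (z' + s * (R / 2)) =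
        z' + s * (r / (R / 2) * (R / 2)) by ring, div_mul_cancel₀ _ hRpos.ne']
    have e2 : (1 - r / (R / 2)) * t' + r / (R / 2) * t' = t' := by ring
    rw [e1, e2] at this
    have h3 : L' * r < r / (R / 2) * (loss (z' + s * (R / 2)) t' - loss z' t') := by linarith
    rw [div_mul_eq_mul_div, lt_div_iff₀ hRpos] at h3
    have h4 : r * (L' * (R / 2)) < r * (loss (z' + s * (R / 2)) t' - loss z' t') := by linarith
    linarith [lt_of_mul_lt_mul_left h4 hr.le]
  have := hconv.2 (Set.mem_univ (z + s * R, t)) (Set.mem_univ (2 * z' - z, 2 * t' - t))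
    (by norm_num : (0 : ℝ) ≤ 1 / 2) (by norm_num : (0 : ℝ) ≤ 1 / 2) (by norm_num)
  simp only [Prod.smul_mk, Prod.mk_add_mk, smul_eq_mul] at this
  have e1 : 1 / 2 * (z + s * R) + 1 / 2 * (2 * z' - z) = z' + s * (R / 2) := by ring
  have e2 : 1 / 2 * t + 1 / 2 * (2 * t' - t) = t' := by ring
  rw [e1, e2] at this
  linarith

/-- Every value below the worst case over a transport ball is exceeded by moving a fraction `ε` of
the mass of each atom. -/
def Reaches (N : ℕ) (q L : ℝ) (loss : ℝ → ℝ → ℝ) : Prop :=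
  ∀ p ∈ stdSimplex ℝ (Fin N), ∀ (a : Fin N → ℝ) (κ δ t c : ℝ), 0 ≤ κ → 0 ≤ δ →
    c < (∑ i, p i * loss (a i) t ^ q) ^ (1 / q) + L * δ ^ (1 / q) * κ →
    ∃ ε ∈ Set.Icc (0 : ℝ) 1, ∃ r : Fin N → ℝ, ε * ∑ i, p i * |r i| ^ q ≤ δ ∧
      c < (∑ i, p i * ((1 - ε) * loss (a i) t ^ q + ε * loss (a i + κ * r i) t ^ q)) ^ (1 / q)

/-- Moving a vanishing fraction of the mass to infinity picks up the asymptotic slope. -/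
theorem exists_shift_of_asymptotic_slope {q : ℝ} (hq : 1 ≤ q) {p : Fin N → ℝ}
    (hp : p ∈ stdSimplex ℝ (Fin N)) {g : ℝ → ℝ} (hg : ∀ z, 0 ≤ g z) {s : ℝ}
    (hs : s = 1 ∨ s = -1) {L : ℝ} (hL : ∀ z, ∃ K R₀ : ℝ, ∀ R ≥ R₀, L * R + K ≤ g (z + s * R))
    (a : Fin N → ℝ) {κ δ c : ℝ} (hκ : 0 < κ) (hδ : 0 < δ) (hL0 : 0 ≤ L)
    (hc : c < (∑ i, p i * g (a i) ^ q + (L * κ * δ ^ (1 / q)) ^ q) ^ (1 / q)) :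
    ∃ ε ∈ Set.Icc (0 : ℝ) 1, ∃ r : Fin N → ℝ, ε * ∑ i, p i * |r i| ^ q ≤ δ ∧
      c < (∑ i, p i * ((1 - ε) * g (a i) ^ q + ε * g (a i + κ * r i) ^ q)) ^ (1 / q) := by
  have hq0 : 0 < q := by linarith
  choose K R₀ hK using hL
  -- With the fraction `η^q` moved by `δ^(1/q)/η` the budget is exactly `δ`, and `η` times the loss
  -- there is at least `L κ δ^(1/q) + K η`. The value at `η = 0` is the target; the maximum with `0`
  -- keeps the base of the power nonnegative.
  have hcont : ContinuousAt (fun η : ℝ => (∑ i, p i * ((1 - η ^ q) * g (a i) ^ q +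
      (max (L * κ * δ ^ (1 / q) + K (a i) * η) 0) ^ q)) ^ (1 / q)) 0 := by
    have h1 : Continuous fun η : ℝ => η ^ q := Real.continuous_rpow_const hq0.le
    have h2 : Continuous fun η : ℝ => η ^ (1 / q) := Real.continuous_rpow_const (by positivity)
    refine (h2.comp (continuous_finsetSum _ fun i _ => continuous_const.mul ?_)).continuousAt
    exact ((continuous_const.sub h1).mul continuous_const).add
      (h1.comp ((continuous_const.add (continuous_const.mul continuous_id)).max continuous_const))
  have hval : c < (∑ i, p i * ((1 - (0 : ℝ) ^ q) * g (a i) ^ q +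
      (max (L * κ * δ ^ (1 / q) + K (a i) * 0) 0) ^ q)) ^ (1 / q) := by
    have : ∀ i, max (L * κ * δ ^ (1 / q) + K (a i) * 0) 0 = L * κ * δ ^ (1 / q) := fun i => by
      rw [mul_zero, add_zero, max_eq_left (by positivity)]
    simp only [this, Real.zero_rpow hq0.ne', sub_zero, one_mul, mul_add, Finset.sum_add_distrib]
    rwa [← Finset.sum_mul _ _ ((L * κ * δ ^ (1 / q)) ^ q), hp.2, one_mul]
  have hev := hcont.eventually (lt_mem_nhds hval)
  have hδq : 0 < δ ^ (1 / q) := by positivity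
  have hbig : ∀ i, ∀ᶠ η in nhdsWithin (0 : ℝ) (Set.Ioi 0),
      R₀ (a i) ≤ κ * δ ^ (1 / q) * η⁻¹ := fun i =>
    (tendsto_inv_nhdsGT_zero.const_mul_atTop (by positivity)).eventually_ge_atTop _
  obtain ⟨η, hη, hηK, hη0, hη1⟩ := ((hev.filter_mono nhdsWithin_le_nhds).and
    ((Filter.eventually_all.2 hbig).and
      (Ioo_mem_nhdsGT (zero_lt_one : (0 : ℝ) < 1)))).exists
  have hηq : 0 ≤ η ^ q := by positivity
  refine ⟨η ^ q, ⟨hηq, Real.rpow_le_one hη0.le hη1.le hq0.le⟩,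
    fun _ => s * (δ ^ (1 / q) * η⁻¹), ?_, hη.trans_le ?_⟩
  · have : |s * (δ ^ (1 / q) * η⁻¹)| = δ ^ (1 / q) * η⁻¹ := by
      have hs1 : |s| = 1 := by rcases hs with rfl | rfl <;> simp
      rw [abs_mul, hs1, one_mul, abs_of_nonneg (by positivity)]
    simp only [this]
    rw [← Finset.sum_mul, hp.2, one_mul, ← Real.mul_rpow hη0.le (by positivity)]
    rw [mul_comm η, mul_assoc, inv_mul_cancel₀ hη0.ne', mul_one, ← Real.rpow_mul hδ.le,
      one_div_mul_cancel hq0.ne', Real.rpow_one]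
  · have h1q : η ^ q ≤ 1 := Real.rpow_le_one hη0.le hη1.le hq0.le
    refine Real.rpow_le_rpow (Finset.sum_nonneg fun i _ => mul_nonneg (hp.1 i) (add_nonneg
      (mul_nonneg (by linarith) (Real.rpow_nonneg (hg _) _)) (by positivity)))
      (Finset.sum_le_sum fun i _ => mul_le_mul_of_nonneg_left ?_ (hp.1 i)) (by positivity)
    gcongr
    rw [← Real.mul_rpow hη0.le (hg _)]
    refine Real.rpow_le_rpow (le_max_right _ _) (max_le ?_ (mul_nonneg hη0.le (hg _))) hq0.le
    have := mul_le_mul_of_nonneg_left (hK (a i) _ (hηK i)) hη0.le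
    have e : a i + s * (κ * δ ^ (1 / q) * η⁻¹) = a i + κ * (s * (δ ^ (1 / q) * η⁻¹)) := by ring
    rw [e] at this
    refine le_trans (le_of_eq ?_) this
    field_simp

/-- For `q = 1` the contribution of the escaping mass adds linearly to the current loss, so it
yields the whole bound. The strict inequality leaves room to replace `L` by a slightly smaller slope
`L'`. -/
theorem reaches_one {loss : ℝ → ℝ → ℝ} {L : ℝ≥0} (hl : ∀ z t, 0 ≤ loss z t)
    (hconv : ConvexOn ℝ Set.univ fun x : ℝ × ℝ => loss x.1 x.2)
    (hL : IsLeast {K : ℝ≥0 | ∀ t, LipschitzWith K fun z => loss z t} L) :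
    Reaches N 1 L loss := by
  intro p hp a κ δ t c hκ hδ hc
  by_cases h0 : (L : ℝ) * δ * κ = 0
  · refine ⟨0, ⟨le_rfl, zero_le_one⟩, 0, by simpa using hδ, ?_⟩
    simp only [Real.rpow_one, div_one, h0, add_zero] at hc
    simpa using hc
  have hL0 : 0 < (L : ℝ) := lt_of_le_of_ne L.2 fun h => h0 (by rw [← h]; ring)
  have hδ0 : 0 < δ := lt_of_le_of_ne hδ fun h => h0 (by rw [← h]; ring)
  have hκ0 : 0 < κ := lt_of_le_of_ne hκ fun h => h0 (by rw [← h]; ring)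
  simp only [Real.rpow_one, div_one] at hc
  obtain ⟨L', hL1, hL2⟩ := exists_between (max_lt hL0 (show
    (c - ∑ i, p i * loss (a i) t) / (δ * κ) < L by
      rw [div_lt_iff₀ (by positivity)]; linarith))
  obtain ⟨hL1, hL3⟩ := max_lt_iff.1 hL1
  obtain ⟨s, hs, hsl⟩ := exists_asymptotic_slope hconv hL hL1.le hL2
  refine exists_shift_of_asymptotic_slope le_rfl hp (fun z => hl z t) hs (hsl t) a hκ0 hδ0 hL1.le ?_
  rw [div_lt_iff₀ (by positivity)] at hL3
  simp only [Real.rpow_one, div_one]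
  linarith

/-- The losses `C · max (z - t - c₁, σ z + θ t - c₂, 0)` with `σ = ±1`. -/
theorem IsSpecialLoss.exists_eq {C : ℝ} {loss : ℝ → ℝ → ℝ} (h : IsSpecialLoss C loss) :
    ∃ σ θ c₁ c₂ : ℝ, (σ = 1 ∨ σ = -1) ∧
      ∀ z t, loss z t = C * max (max (z - t - c₁) (σ * z + θ * t - c₂)) 0 := by
  rcases h with ⟨b, h⟩ | ⟨b₁, b₂, hb, h⟩ | ⟨b₁, b₂, hb, h⟩ | h
  · refine ⟨1, -1, b, b, Or.inl rfl, fun z t => ?_⟩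
    rw [h, show 1 * z + -1 * t - b = z - t - b by ring, max_self]
  · refine ⟨-1, 1, b₁ + b₂, b₂ - b₁, Or.inr rfl, fun z t => ?_⟩
    rw [h, abs_eq_max_neg, ← max_sub_sub_right]
    congr 3 <;> ring
  · refine ⟨-1, 1, b₁ - b₂, -b₁ - b₂, Or.inr rfl, fun z t => ?_⟩
    have : max (z - t - (b₁ - b₂)) (-1 * z + 1 * t - (-b₁ - b₂)) = |z - t - b₁| + b₂ := by
      rw [abs_eq_max_neg, ← max_add_add_right]
      congr 1 <;> ring
    rw [h, this, max_eq_left (by positivity)]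
  · refine ⟨-1, -1, 0, 0, Or.inr rfl, fun z t => ?_⟩
    rw [h, abs_eq_max_neg, ← max_sub_sub_right]
    congr 3 <;> ring

section SpecialLoss

variable {C : ℝ} {loss : ℝ → ℝ → ℝ}

theorem IsSpecialLoss.nonneg (hC : 1 < C) (h : IsSpecialLoss C loss) (z t : ℝ) : 0 ≤ loss z t := by
  obtain ⟨σ, θ, c₁, c₂, -, h⟩ := h.exists_eq
  rw [h]
  exact mul_nonneg (by linarith) (le_max_right _ _)

theorem IsSpecialLoss.convexOn (hC : 1 < C) (h : IsSpecialLoss C loss) :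
    ConvexOn ℝ Set.univ fun x : ℝ × ℝ => loss x.1 x.2 := by
  obtain ⟨σ, θ, c₁, c₂, -, h⟩ := h.exists_eq
  simp only [h]
  have haff : ∀ σ θ c : ℝ, ConvexOn ℝ Set.univ fun x : ℝ × ℝ => σ * x.1 + θ * x.2 - c := by
    refine fun σ θ c => ⟨convex_univ, fun x _ y _ a b _ _ hab => le_of_eq ?_⟩
    simp only [Prod.fst_add, Prod.snd_add, Prod.smul_fst, Prod.smul_snd, smul_eq_mul]
    linear_combination c * hab
  have h1 := haff 1 (-1) c₁
  simp only [one_mul, neg_mul, ← sub_eq_add_neg] at h1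
  exact ((h1.sup (haff σ θ c₂)).sup (convexOn_const 0 convex_univ)).smul (by linarith)

theorem IsSpecialLoss.lipschitzWith (hC : 1 < C) (h : IsSpecialLoss C loss) (t : ℝ) :
    LipschitzWith C.toNNReal fun z => loss z t := by
  have hC0 : 0 ≤ C := by linarith
  obtain ⟨σ, θ, c₁, c₂, hσ, h⟩ := h.exists_eq
  refine LipschitzWith.of_dist_le_mul fun x y => ?_
  simp only [h, Real.dist_eq, Real.coe_toNNReal _ hC0, ← mul_sub, abs_mul, abs_of_nonneg hC0]
  refine mul_le_mul_of_nonneg_left ?_ hC0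
  refine (abs_max_sub_max_le_abs _ _ _).trans ((abs_max_sub_max_le_max _ _ _ _).trans ?_)
  refine max_le (le_of_eq (by congr 1; ring)) (le_of_eq ?_)
  rw [show σ * x + θ * t - c₂ - (σ * y + θ * t - c₂) = σ * (x - y) by ring, abs_mul]
  rcases hσ with rfl | rfl <;> simp

/-- As `t → -∞` the loss grows at least like `-C t`, which beats `t` because `C > 1`; nonnegativity
bounds `t` from above. -/
theorem IsSpecialLoss.isBounded (hC : 1 < C) (h : IsSpecialLoss C loss) (z c : ℝ) :
    Bornology.IsBounded {t : ℝ | t + loss z t ≤ c} := by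
  obtain ⟨σ, θ, c₁, c₂, -, h'⟩ := h.exists_eq
  refine (Metric.isBounded_Icc ((C * (z - c₁) - c) / (C - 1)) c).subset fun t ht => ?_
  have h0 := h.nonneg hC z t
  have ht' : t + loss z t ≤ c := ht
  refine ⟨?_, by linarith⟩
  rw [div_le_iff₀ (by linarith)]
  have : C * (z - t - c₁) ≤ loss z t := by
    rw [h']
    exact mul_le_mul_of_nonneg_left ((le_max_left _ _).trans (le_max_left _ _)) (by linarith)
  linarith

/-- A positive loss equals `C` times one of the two affine pieces; moving in the direction in which
that piece increases gains `C` per unit, and the maximum stays above it. -/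
theorem IsSpecialLoss.exists_slope (hC : 1 < C) (h : IsSpecialLoss C loss) {z t : ℝ}
    (hpos : 0 < loss z t) :
    ∃ s : ℝ, (s = 1 ∨ s = -1) ∧ ∀ r ≥ 0, loss z t + C * r ≤ loss (z + s * r) t := by
  have hC0 : 0 < C := by linarith
  obtain ⟨σ, θ, c₁, c₂, hσ, h'⟩ := h.exists_eq
  rw [h'] at hpos
  have hm : 0 < max (z - t - c₁) (σ * z + θ * t - c₂) := by
    by_contra! hle
    rw [max_eq_right hle] at hpos
    simp at hpos
  have hlz : loss z t = C * max (z - t - c₁) (σ * z + θ * t - c₂) := by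
    rw [h', max_eq_left hm.le]
  rcases max_choice (z - t - c₁) (σ * z + θ * t - c₂) with he | he
  · refine ⟨1, Or.inl rfl, fun r hr => ?_⟩
    rw [hlz, he, h', ← mul_add]
    refine mul_le_mul_of_nonneg_left (le_trans ?_ ((le_max_left _ _).trans (le_max_left _ _))) hC0.le
    linarith
  · refine ⟨σ, hσ, fun r hr => ?_⟩
    rw [hlz, he, h', ← mul_add]
    refine mul_le_mul_of_nonneg_left
      (le_trans ?_ ((le_max_right _ _).trans (le_max_left _ _))) hC0.le
    have : σ * σ = 1 := by rcases hσ with rfl | rfl <;> norm_num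
    linear_combination (-r) * this

theorem IsSpecialLoss.asymptotic_slope (hC : 1 < C) (h : IsSpecialLoss C loss) (t z : ℝ) :
    ∃ K R₀ : ℝ, ∀ R ≥ R₀, C * R + K ≤ loss (z + 1 * R) t := by
  obtain ⟨σ, θ, c₁, c₂, -, h'⟩ := h.exists_eq
  refine ⟨C * (z - t - c₁), 0, fun R _ => ?_⟩
  rw [h', ← mul_add]
  refine mul_le_mul_of_nonneg_left (le_trans ?_ ((le_max_left _ _).trans (le_max_left _ _)))
    (by linarith)
  linarith

/-- If the current loss vanishes almost surely, escaping mass suffices. Otherwise all atoms are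
shifted by multiples of their own losses: the new losses dominate a multiple of the old ones, so the
two terms of Minkowski add. -/
theorem IsSpecialLoss.reaches (hC : 1 < C) (h : IsSpecialLoss C loss) {q : ℝ} (hq : 1 < q) :
    Reaches N q C loss := by
  intro p hp a κ δ t c hκ hδ hc
  have hC0 : 0 < C := by linarith
  have hq0 : 0 < q := by linarith
  by_cases h0 : δ ^ (1 / q) * κ = 0
  · refine ⟨0, ⟨le_rfl, zero_le_one⟩, 0, by simpa using hδ, ?_⟩
    rw [mul_assoc, h0, mul_zero, add_zero] at hc
    simpa using hc
  have hκ0 : 0 < κ := lt_of_le_of_ne hκ fun h => h0 (by rw [← h]; ring)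
  have hδ0 : 0 < δ := lt_of_le_of_ne hδ fun h => h0 (by
    rw [← h, Real.zero_rpow (by positivity), zero_mul])
  have hl := h.nonneg hC
  have hS : 0 ≤ ∑ i, p i * loss (a i) t ^ q :=
    Finset.sum_nonneg fun i _ => mul_nonneg (hp.1 i) (Real.rpow_nonneg (hl _ _) _)
  rcases hS.eq_or_lt with hz | hpos
  · refine exists_shift_of_asymptotic_slope hq.le hp (fun z => hl z t) (Or.inl rfl)
      (h.asymptotic_slope hC t) a hκ0 hδ0 hC0.le ?_
    rw [← hz, Real.zero_rpow (by positivity), zero_add] at hc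
    rw [← hz, zero_add, ← Real.rpow_mul (by positivity), mul_one_div_cancel hq0.ne', Real.rpow_one]
    linarith
  set M := (∑ i, p i * loss (a i) t ^ q) ^ (1 / q) with hM
  have hMpos : 0 < M := by positivity
  have hMq : M ^ q = ∑ i, p i * loss (a i) t ^ q := by
    rw [hM, ← Real.rpow_mul hS, one_div_mul_cancel hq0.ne', Real.rpow_one]
  have hsl : ∀ i, ∃ s : ℝ, (s = 1 ∨ s = -1) ∧ (0 < loss (a i) t →
      ∀ r ≥ 0, loss (a i) t + C * r ≤ loss (a i + s * r) t) := by
    intro i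
    by_cases hi : 0 < loss (a i) t
    · obtain ⟨s, hs, hs'⟩ := h.exists_slope hC hi
      exact ⟨s, hs, fun _ => hs'⟩
    · exact ⟨1, Or.inl rfl, fun h => absurd h hi⟩
  choose s hs1 hs using hsl
  -- The factor for which the shifts `k * loss` spend exactly the budget `δ`, since the `q`-th
  -- powers of the losses average to `M ^ q`.
  set k : ℝ := δ ^ (1 / q) / M with hk
  have hk0 : 0 ≤ k := by positivity
  refine ⟨1, ⟨zero_le_one, le_rfl⟩, fun i => s i * (k * loss (a i) t), le_of_eq ?_, hc.trans_le ?_⟩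
  · have : ∀ i, |s i * (k * loss (a i) t)| ^ q = k ^ q * loss (a i) t ^ q := by
      intro i
      have hs2 : |s i| = 1 := by rcases hs1 i with h | h <;> simp [h]
      rw [abs_mul, hs2, one_mul, abs_of_nonneg (mul_nonneg hk0 (hl _ _)),
        Real.mul_rpow hk0 (hl _ _)]
    simp only [this, mul_left_comm _ (k ^ q), ← Finset.mul_sum]
    rw [← hMq, one_mul, hk, Real.div_rpow (by positivity) hMpos.le,
      div_mul_cancel₀ _ (by positivity), ← Real.rpow_mul hδ, one_div_mul_cancel hq0.ne',
      Real.rpow_one]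
  · have hfac : 0 ≤ 1 + C * κ * k := by positivity
    have hsum : M + C * δ ^ (1 / q) * κ =
        (∑ i, p i * ((1 + C * κ * k) * loss (a i) t) ^ q) ^ (1 / q) := by
      simp only [Real.mul_rpow hfac (hl _ _), mul_left_comm _ ((1 + C * κ * k) ^ q),
        ← Finset.mul_sum]
      rw [Real.mul_rpow (by positivity) hS, ← Real.rpow_mul hfac, mul_one_div_cancel hq0.ne',
        Real.rpow_one, ← hM, hk]
      field_simp
    rw [hsum]
    refine Real.rpow_le_rpow (Finset.sum_nonneg fun i _ => mul_nonneg (hp.1 i)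
      (Real.rpow_nonneg (mul_nonneg hfac (hl _ _)) _)) (Finset.sum_le_sum fun i _ =>
      mul_le_mul_of_nonneg_left ?_ (hp.1 i)) (by positivity)
    rw [sub_self, zero_mul, zero_add, one_mul]
    refine Real.rpow_le_rpow (mul_nonneg hfac (hl _ _)) ?_ hq0.le
    rcases (hl (a i) t).eq_or_lt with hz | hp
    · rw [← hz, mul_zero]; exact hl _ _
    · have := hs i hp (κ * (k * loss (a i) t)) (by positivity)
      rw [show κ * (s i * (k * loss (a i) t)) = s i * (κ * (k * loss (a i) t)) by ring]
      refine le_trans (le_of_eq ?_) this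
      ring

end SpecialLoss

end Reach

/-! ### Worst-case risk over the union of balls -/

section WorstCase

/-- Compactness of the unit ball gives attainment. Moving by `r • u` changes `α y` by `‖α‖ r` at
cost at most `|r|^q`, which reduces transport in `E` to transport on a line. -/
theorem exists_norm_le_one_apply_eq_norm {E : Type*} [NormedAddCommGroup E] [NormedSpace ℝ E]
    [FiniteDimensional ℝ E] (α : StrongDual ℝ E) :
    ∃ u : E, ‖u‖ ≤ 1 ∧ α u = ‖α‖ := by
  obtain ⟨u, hu, hmax⟩ := (isCompact_closedBall (0 : E) 1).exists_isMaxOn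
    ⟨0, Metric.mem_closedBall_self zero_le_one⟩ α.continuous.continuousOn
  have hu1 : ‖u‖ ≤ 1 := mem_closedBall_zero_iff.1 hu
  refine ⟨u, hu1, le_antisymm ?_ ?_⟩
  · refine (le_abs_self _).trans ((α.le_opNorm u).trans ?_)
    exact mul_le_of_le_one_right (norm_nonneg _) hu1
  · have h0 : 0 ≤ α u := by
      have := hmax (Metric.mem_closedBall_self zero_le_one)
      simpa using this
    refine ContinuousLinearMap.opNorm_le_of_unit_norm h0 fun x hx => ?_
    rw [Real.norm_eq_abs, abs_le]
    have h1 : α (-x) ≤ α u := hmax (mem_closedBall_zero_iff.2 (by rw [norm_neg, hx]))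
    have h2 : α x ≤ α u := hmax (mem_closedBall_zero_iff.2 hx.le)
    rw [map_neg] at h1
    exact ⟨by linarith, h2⟩

variable {E : Type*} [NormedAddCommGroup E] [MeasurableSpace E] {N : ℕ}

theorem lintegral_sum_smul_dirac {Ω ι : Type*} [MeasurableSpace Ω] [MeasurableSingletonClass Ω]
    (s : Finset ι) (w : ι → ℝ) (y : ι → Ω) {h : Ω → ℝ} (hw : ∀ i ∈ s, 0 ≤ w i) (hh : ∀ z, 0 ≤ h z) :
    ∫⁻ z, ENNReal.ofReal (h z) ∂(∑ i ∈ s, ENNReal.ofReal (w i) • Measure.dirac (y i)) =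
      ENNReal.ofReal (∑ i ∈ s, w i * h (y i)) := by
  rw [lintegral_finsetSum_measure,
    ENNReal.ofReal_sum_of_nonneg fun i hi => mul_nonneg (hw i hi) (hh _)]
  refine Finset.sum_congr rfl fun i hi => ?_
  rw [lintegral_smul_measure, lintegral_dirac, ENNReal.ofReal_mul (hw i hi), smul_eq_mul]

theorem nonneg_of_mem_otBall {q δ : ℝ} {P Q : Measure E} (h : Q ∈ otBall q δ P) : 0 ≤ δ :=
  EReal.coe_nonneg.1 ((EReal.coe_ennreal_nonneg _).trans h.2)

variable [NormedSpace ℝ E] [FiniteDimensional ℝ E] [BorelSpace E]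

/-- A transport ball increases the `L^q` norm of a Lipschitz loss by at most
`L · δ ^ (1 / q) · ‖α‖`. -/
theorem lintegral_rpow_le_of_mem_otBall {q δ : ℝ} (hq : 1 ≤ q) {g : ℝ → ℝ} (hg : ∀ z, 0 ≤ g z)
    {L : ℝ≥0} (hL : LipschitzWith L g) (α : StrongDual ℝ E) (yhat : Fin N → E) {p : Fin N → ℝ}
    (hp : ∀ i, 0 ≤ p i) {Q : Measure E} (hQ : Q ∈ otBall q δ (discreteLaw yhat p)) :
    (∫⁻ y, ENNReal.ofReal (g (α y) ^ q) ∂Q) ^ (1 / q) ≤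
      ENNReal.ofReal ((∑ i, p i * g (α (yhat i)) ^ q) ^ (1 / q) + L * δ ^ (1 / q) * ‖α‖) := by
  have hq0 : 0 < q := by linarith
  have hδ := nonneg_of_mem_otBall hQ
  have hcost : transportCost q Q (discreteLaw yhat p) ≤ ENNReal.ofReal δ := by
    rw [← EReal.coe_ennreal_le_coe_ennreal_iff, EReal.coe_ennreal_ofReal, max_eq_left hδ]
    exact hQ.2
  have hgc : Continuous fun y : E => g (α y) := hL.continuous.comp α.continuous
  have hsum0 : 0 ≤ ∑ i, p i * g (α (yhat i)) ^ q :=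
    Finset.sum_nonneg fun i _ => mul_nonneg (hp i) (Real.rpow_nonneg (hg _) _)
  -- A slightly larger radius provides a coupling without using that the optimal cost is attained;
  -- continuity then lets `δ'` decrease to `δ`.
  have key : ∀ δ' > δ, (∫⁻ y, ENNReal.ofReal (g (α y) ^ q) ∂Q) ^ (1 / q) ≤
      ENNReal.ofReal ((∑ i, p i * g (α (yhat i)) ^ q) ^ (1 / q) + L * δ' ^ (1 / q) * ‖α‖) := by
    intro δ' hδ'
    have hδ'0 : 0 < δ' := hδ.trans_lt hδ'
    have hlt := hcost.trans_lt ((ENNReal.ofReal_lt_ofReal_iff hδ'0).2 hδ')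
    rw [transportCost] at hlt
    simp only [iInf_lt_iff] at hlt
    obtain ⟨π, ⟨hπ1, hπ2⟩, hπ⟩ := hlt
    set f₁ : E × E → ℝ≥0∞ := fun z => ENNReal.ofReal (g (α z.2)) with hf₁
    set f₂ : E × E → ℝ≥0∞ := fun z => ENNReal.ofReal (L * ‖α‖ * ‖z.1 - z.2‖) with hf₂
    have hof : ∀ x : ℝ, 0 ≤ x → ENNReal.ofReal (x ^ q) = ENNReal.ofReal x ^ q := fun x hx =>
      (ENNReal.ofReal_rpow_of_nonneg hx hq0.le).symm
    have hm : Measurable fun y : E => ENNReal.ofReal (g (α y) ^ q) :=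
      ((hgc.rpow_const fun _ => Or.inr hq0.le).measurable).ennreal_ofReal
    have h1 : ∫⁻ y, ENNReal.ofReal (g (α y) ^ q) ∂Q ≤ ∫⁻ z, (f₁ + f₂) z ^ q ∂π := by
      rw [← hπ1, lintegral_map hm measurable_fst]
      refine lintegral_mono fun z => ?_
      rw [hof _ (hg _)]
      refine ENNReal.rpow_le_rpow ?_ hq0.le
      rw [Pi.add_apply, hf₁, hf₂, ← ENNReal.ofReal_add (hg _) (by positivity)]
      refine ENNReal.ofReal_le_ofReal ?_
      have h3 := (le_abs_self _).trans (hL.dist_le_mul (α z.1) (α z.2))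
      rw [Real.dist_eq, ← map_sub] at h3
      have h4 := mul_le_mul_of_nonneg_left (α.le_opNorm (z.1 - z.2)) L.2
      rw [Real.norm_eq_abs] at h4
      change _ ≤ g (α z.2) + L * ‖α‖ * ‖z.1 - z.2‖
      change (L : ℝ) * |α (z.1 - z.2)| ≤ L * (‖α‖ * ‖z.1 - z.2‖) at h4
      linarith
    have h2 := ENNReal.lintegral_Lp_add_le (μ := π) (p := q) (f := f₁) (g := f₂)
      (((hgc.comp continuous_snd).measurable).ennreal_ofReal.aemeasurable)
      ((((continuous_fst.sub continuous_snd).norm.measurable).const_mul _).ennreal_ofReal.aemeasurable)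
      hq
    have h3 : ∫⁻ z, f₁ z ^ q ∂π = ENNReal.ofReal (∑ i, p i * g (α (yhat i)) ^ q) := by
      have : ∀ z, f₁ z ^ q = ENNReal.ofReal (g (α z.2) ^ q) := fun z => (hof _ (hg _)).symm
      simp only [this]
      rw [← lintegral_map hm measurable_snd, hπ2, discreteLaw,
        lintegral_sum_smul_dirac _ _ _ (fun i _ => hp i) fun y => Real.rpow_nonneg (hg _) _]
    have h4 : ∫⁻ z, f₂ z ^ q ∂π ≤ ENNReal.ofReal ((L * ‖α‖) ^ q * δ') := by
      have : ∀ z, f₂ z ^ q =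
          ENNReal.ofReal ((L * ‖α‖) ^ q) * ENNReal.ofReal (‖z.1 - z.2‖ ^ q) := fun z => by
        rw [← ENNReal.ofReal_mul (by positivity), ← Real.mul_rpow (by positivity) (norm_nonneg _),
          hof _ (by positivity)]
      simp only [this]
      rw [lintegral_const_mul' _ _ ENNReal.ofReal_ne_top, ENNReal.ofReal_mul (by positivity)]
      gcongr
    refine (ENNReal.rpow_le_rpow h1 (by positivity)).trans (h2.trans ?_)
    rw [h3, ENNReal.ofReal_add (by positivity) (by positivity),
      ENNReal.ofReal_rpow_of_nonneg hsum0 (by positivity)]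
    refine add_le_add le_rfl ?_
    refine (ENNReal.rpow_le_rpow h4 (by positivity)).trans (le_of_eq ?_)
    rw [ENNReal.ofReal_rpow_of_nonneg (by positivity) (by positivity),
      Real.mul_rpow (by positivity) hδ'0.le, ← Real.rpow_mul (by positivity),
      mul_one_div_cancel hq0.ne', Real.rpow_one]
    congr 1
    ring
  have hcont : Continuous fun δ' : ℝ => ENNReal.ofReal
      ((∑ i, p i * g (α (yhat i)) ^ q) ^ (1 / q) + L * δ' ^ (1 / q) * ‖α‖) :=
    ENNReal.continuous_ofReal.comp (continuous_const.add
      ((continuous_const.mul (Real.continuous_rpow_const (by positivity))).mul continuous_const))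
  refine ge_of_tendsto ((hcont.tendsto δ).mono_left nhdsWithin_le_nhds)
    (Filter.eventually_of_mem (self_mem_nhdsWithin (s := Set.Ioi δ)) key)

theorem worstCaseRisk_le {q : ℝ} (hq : 1 ≤ q) {loss : ℝ → ℝ → ℝ} (hl : ∀ z t, 0 ≤ loss z t)
    {L : ℝ≥0} (hL : ∀ t, LipschitzWith L fun z => loss z t) (yhat : Fin N → E)
    {V : Set ((Fin N → ℝ) × ℝ)} (hVp : ∀ x ∈ V, x.1 ∈ stdSimplex ℝ (Fin N)) (α : StrongDual ℝ E) :
    worstCaseRisk q loss yhat V α ≤ ⨅ t : ℝ, robustObjQ q loss L yhat V α t := by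
  refine iSup₂_le fun Q hQ => iInf_mono fun t => ?_
  simp only [unionBall, Set.mem_iUnion] at hQ
  obtain ⟨x, hx, hQ⟩ := hQ
  have hδ := nonneg_of_mem_otBall hQ
  refine le_trans ?_ (le_iSup₂_of_le x ⟨hx, hδ⟩ le_rfl)
  have h1 := lintegral_rpow_le_of_mem_otBall hq (fun z => hl z t) (hL t) α yhat (hVp x hx).1 hQ
  rw [← EReal.coe_ennreal_le_coe_ennreal_iff, EReal.coe_ennreal_ofReal, max_eq_left (by
    have : 0 ≤ ∑ i, x.1 i * loss (α (yhat i)) t ^ q := Finset.sum_nonneg fun i _ =>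
      mul_nonneg ((hVp x hx).1 i) (Real.rpow_nonneg (hl _ _) _)
    positivity)] at h1
  rw [add_assoc, EReal.coe_add]
  gcongr

/-- The first marginal of a transport plan along a direction that attains the dual norm. -/
theorem exists_mem_unionBall_of_plan {q : ℝ} (hq : 1 ≤ q) {loss : ℝ → ℝ → ℝ}
    (hl : ∀ z t, 0 ≤ loss z t) (yhat : Fin N → E)
    {V : Set ((Fin N → ℝ) × ℝ)} (hVp : ∀ x ∈ V, x.1 ∈ stdSimplex ℝ (Fin N)) (α : StrongDual ℝ E)
    {m : (Fin N × ℝ) →₀ ℝ} (hm : m ∈ planSet q V) :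
    ∃ Q ∈ unionBall q yhat V, rhoTwo q loss Q (fun y => α y) =
      ⨅ t : ℝ, (planRisk q loss (fun i => α (yhat i)) ‖α‖ m t : EReal) := by
  have hq0 : 0 < q := by linarith
  obtain ⟨u, hu, hαu⟩ := exists_norm_le_one_apply_eq_norm α
  have hsum := sum_eq_one_of_mem_planSet hVp hm
  obtain ⟨hm0, x, hx, hmx, hmc⟩ := hm
  set y : Fin N × ℝ → E := fun k => yhat k.1 + k.2 • u with hy
  set Q : Measure E := ∑ k ∈ m.support, ENNReal.ofReal (m k) • Measure.dirac (y k) with hQ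
  set π : Measure (E × E) :=
    -- Each moved atom is paired with its origin, so the second marginal is the discrete law and the
    -- cost is at most that of the plan.
    ∑ k ∈ m.support, ENNReal.ofReal (m k) • Measure.dirac (y k, yhat k.1) with hπ
  have hπ1 : π.map Prod.fst = Q := by
    rw [hπ, hQ, Measure.map_finset_sum measurable_fst.aemeasurable]
    refine Finset.sum_congr rfl fun k _ => ?_
    rw [Measure.map_smul, Measure.map_dirac' measurable_fst]
  have hπ2 : π.map Prod.snd = discreteLaw yhat x.1 := by
    rw [hπ, discreteLaw, Measure.map_finset_sum measurable_snd.aemeasurable,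
      ← Finset.sum_fiberwise m.support Prod.fst]
    refine Finset.sum_congr rfl fun i _ => ?_
    have hxi : x.1 i = ∑ k ∈ m.support with k.1 = i, m k := by
      rw [← hmx, Finsupp.linearCombination_apply, Finsupp.sum, Finset.sum_apply,
        Finset.sum_filter]
      refine Finset.sum_congr rfl fun k _ => ?_
      simp [Pi.single_apply, eq_comm]
    rw [hxi, ENNReal.ofReal_sum_of_nonneg fun k _ => hm0 k, Finset.sum_smul]
    refine Finset.sum_congr rfl fun k hk => ?_
    rw [Measure.map_smul, Measure.map_dirac' measurable_snd, (Finset.mem_filter.1 hk).2]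
  have hprob : IsProbabilityMeasure Q := by
    constructor
    simp only [hQ, Measure.finsetSum_apply, Measure.smul_apply, measure_univ, smul_eq_mul, mul_one]
    rw [← ENNReal.ofReal_sum_of_nonneg fun k _ => hm0 k, hsum, ENNReal.ofReal_one]
  refine ⟨Q, Set.mem_iUnion₂.2 ⟨x, hx, hprob, ?_⟩, ?_⟩
  · have hc0 : 0 ≤ Finsupp.linearCombination ℝ (fun k : Fin N × ℝ => |k.2| ^ q) m :=
      Finsupp.linearCombination_nonneg (fun k => by positivity) hm0
    refine le_trans (EReal.coe_ennreal_le_coe_ennreal_iff.2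
      ((iInf₂_le π ⟨hπ1, hπ2⟩).trans (?_ : _ ≤ ENNReal.ofReal (Finsupp.linearCombination ℝ
        (fun k : Fin N × ℝ => |k.2| ^ q) m)))) ?_
    · rw [hπ, lintegral_sum_smul_dirac _ _ _ (fun k _ => hm0 k) fun z => by positivity,
        Finsupp.linearCombination_apply, Finsupp.sum]
      refine ENNReal.ofReal_le_ofReal (Finset.sum_le_sum fun k _ => ?_)
      refine mul_le_mul_of_nonneg_left (Real.rpow_le_rpow (norm_nonneg _) ?_ hq0.le) (hm0 k)
      rw [hy, add_sub_cancel_left, norm_smul, Real.norm_eq_abs]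
      exact mul_le_of_le_one_right (abs_nonneg _) hu
    · rw [EReal.coe_ennreal_ofReal, max_eq_left hc0]
      exact EReal.coe_le_coe_iff.2 hmc
  · refine iInf_congr fun t => ?_
    have h0 : 0 ≤ ∑ k ∈ m.support, m k * loss (α (y k)) t ^ q :=
      Finset.sum_nonneg fun k _ => mul_nonneg (hm0 k) (Real.rpow_nonneg (hl _ _) _)
    rw [hQ, lintegral_sum_smul_dirac (h := fun y => loss (α y) t ^ q) _ _ _ (fun k _ => hm0 k)
      fun y => Real.rpow_nonneg (hl _ _) _,
      ENNReal.ofReal_rpow_of_nonneg h0 (by positivity), EReal.coe_ennreal_ofReal,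
      max_eq_left (by positivity), planRisk, EReal.coe_add, Finsupp.linearCombination_apply,
      Finsupp.sum]
    simp [hy, hαu, mul_comm ‖α‖]

/-- For a real `b` below the right side, every `t` has some pair in `V₊`, hence by `Reaches` some
plan, exceeding `b`. The minimax theorem merges these into one plan good for all `t`, and its first
marginal is the required distribution. -/
theorem worstCaseRisk_eq_iInf_robustObjQ {q : ℝ} (hq : 1 ≤ q) {loss : ℝ → ℝ → ℝ}
    (hl : ∀ z t, 0 ≤ loss z t) (hconv : ConvexOn ℝ Set.univ fun x : ℝ × ℝ => loss x.1 x.2)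
    {L : ℝ≥0} (hL : ∀ t, LipschitzWith L fun z => loss z t)
    (hbdd : ∀ z c : ℝ, Bornology.IsBounded {t : ℝ | t + loss z t ≤ c})
    (hreach : Reaches N q L loss) (yhat : Fin N → E)
    {V : Set ((Fin N → ℝ) × ℝ)} (hV : Convex ℝ V) (hVp : ∀ x ∈ V, x.1 ∈ stdSimplex ℝ (Fin N))
    (α : StrongDual ℝ E) :
    worstCaseRisk q loss yhat V α = ⨅ t : ℝ, robustObjQ q loss L yhat V α t := by
  refine le_antisymm (worstCaseRisk_le hq hl hL yhat hVp α) (le_of_forall_lt fun c hc => ?_)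
  obtain ⟨b, hcb, hb⟩ := EReal.lt_iff_exists_real_btwn.1 hc
  refine hcb.trans_le ?_
  obtain ⟨m, hm, hle⟩ := exists_plan_forall_le (a := fun i => α (yhat i)) (κ := ‖α‖) (c := b)
    hq hl hconv hbdd hV hVp fun t => by
      have ht := hb.trans_le (iInf_le _ t)
      simp only [robustObjQ, lt_iSup_iff, EReal.coe_lt_coe_iff] at ht
      obtain ⟨x, hx, hlt⟩ := ht
      obtain ⟨ε, hε, r, hr, hlt'⟩ := hreach x.1 (hVp x hx.1) (fun i => α (yhat i)) ‖α‖ x.2 t (b - t)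
        (norm_nonneg _) hx.2 (by linarith)
      obtain ⟨m, hm, hmt⟩ := exists_plan_of_shift (a := fun i => α (yhat i)) (κ := ‖α‖)
        (loss := loss) hq hx.1 (hVp x hx.1).1 hε r hr t
      exact ⟨m, hm, by rw [hmt]; linarith⟩
  obtain ⟨Q, hQ, hρ⟩ := exists_mem_unionBall_of_plan hq hl yhat hVp α hm
  refine le_trans ?_ (le_iSup₂_of_le Q hQ le_rfl)
  rw [hρ]
  exact le_iInf fun t => EReal.coe_le_coe_iff.2 (hle t)

end WorstCase

/-! ### Power quotients, Young's inequality and duality for roots -/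

section Programs

theorem div_rpow_le_iff {q g y v : ℝ} (hq : 1 < q) (hg : 0 ≤ g) (hy : 0 < y) :
    g ^ q / y ^ (q - 1) ≤ v ↔ 0 ≤ v ∧ g ≤ v ^ (1 / q) * y ^ (1 - 1 / q) := by
  have hq0 : 0 < q := by linarith
  have hyq : 0 < y ^ (q - 1) := by positivity
  have key : ∀ v : ℝ, 0 ≤ v → (g ^ q / y ^ (q - 1) ≤ v ↔ g ≤ v ^ (1 / q) * y ^ (1 - 1 / q)) := by
    intro v hv
    have e : v ^ (1 / q) * y ^ (1 - 1 / q) = (v * y ^ (q - 1)) ^ (1 / q) := by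
      rw [Real.mul_rpow hv hyq.le, ← Real.rpow_mul hy.le]
      congr 2
      field_simp
    rw [e, div_le_iff₀ hyq, one_div, Real.le_rpow_inv_iff_of_pos hg (by positivity) hq0]
  refine ⟨fun h => ?_, fun h => (key v h.1).2 h.2⟩
  have hv : 0 ≤ v := le_trans (by positivity) h
  exact ⟨hv, (key v hv).1 h⟩

/-- Turns the constraint into the hypograph of a weighted geometric mean, which is concave. The
conventions at `y = 0` fit because `0 ^ (1 - 1 / q) = 0` forces `g = 0`. -/
theorem quotPow_le_iff {q g y v : ℝ} (hq : 1 < q) (hg : 0 ≤ g) (hy : 0 ≤ y) :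
    quotPow q (g ^ q) y ≤ (v : EReal) ↔ 0 ≤ v ∧ g ≤ v ^ (1 / q) * y ^ (1 - 1 / q) := by
  have hq0 : 0 < q := by linarith
  have hq1 : 1 - 1 / q ≠ 0 := (sub_pos.2 ((div_lt_one hq0).2 hq)).ne'
  rcases hy.eq_or_lt with rfl | hy
  · rw [quotPow, if_pos rfl, Real.zero_rpow hq1, mul_zero]
    rcases hg.eq_or_lt with rfl | hg
    · simp [Real.zero_rpow hq0.ne']
    · rw [if_neg (by positivity)]
      simp [hg.not_ge]
  · rw [quotPow, if_neg hy.ne', EReal.coe_le_coe_iff]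
    exact div_rpow_le_iff hq hg hy

/-- Weighted geometric means are concave. -/
theorem geom_mean_concave {q : ℝ} (hq : 1 < q) {a b v v' y y' : ℝ} (ha : 0 ≤ a) (hb : 0 ≤ b)
    (hv : 0 ≤ v) (hv' : 0 ≤ v') (hy : 0 ≤ y) (hy' : 0 ≤ y') :
    a * (v ^ (1 / q) * y ^ (1 - 1 / q)) + b * (v' ^ (1 / q) * y' ^ (1 - 1 / q)) ≤
      (a * v + b * v') ^ (1 / q) * (a * y + b * y') ^ (1 - 1 / q) := by
  have hq0 : 0 < q := by linarith
  have hq1 : 0 < 1 - 1 / q := sub_pos.2 ((div_lt_one hq0).2 hq)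
  have hconj : q.HolderConjugate (q / (q - 1)) := Real.HolderConjugate.conjExponent hq
  have hinv : 1 - 1 / q = 1 / (q / (q - 1)) := by
    have : q - 1 ≠ 0 := by linarith
    field_simp
  have hr : 0 < q / (q - 1) := div_pos hq0 (by linarith)
  have := Real.inner_le_Lp_mul_Lq_of_nonneg Finset.univ hconj
    (f := ![(a * v) ^ (1 / q), (b * v') ^ (1 / q)])
    (g := ![(a * y) ^ (1 - 1 / q), (b * y') ^ (1 - 1 / q)])
    (fun i _ => by fin_cases i <;> simp <;> positivity)
    (fun i _ => by fin_cases i <;> simp only [Fin.zero_eta, Fin.mk_one, Matrix.cons_val_zero,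
      Matrix.cons_val_one] <;> positivity)
  simp only [Fin.sum_univ_two, Matrix.cons_val_zero, Matrix.cons_val_one] at this
  have e1 : ∀ x : ℝ, 0 ≤ x → (x ^ (1 / q)) ^ q = x := fun x hx => by
    rw [← Real.rpow_mul hx, one_div_mul_cancel hq0.ne', Real.rpow_one]
  have e2 : ∀ x : ℝ, 0 ≤ x → (x ^ (1 - 1 / q)) ^ (q / (q - 1)) = x := fun x hx => by
    rw [hinv, ← Real.rpow_mul hx, one_div_mul_cancel hr.ne', Real.rpow_one]
  rw [e1 _ (by positivity), e1 _ (by positivity), e2 _ (by positivity), e2 _ (by positivity),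
    ← hinv] at this
  refine le_trans (le_of_eq ?_) this
  have e3 : ∀ a v y : ℝ, 0 ≤ a → 0 ≤ v → 0 ≤ y → a * (v ^ (1 / q) * y ^ (1 - 1 / q)) =
      (a * v) ^ (1 / q) * (a * y) ^ (1 - 1 / q) := by
    intro a v y ha hv hy
    have : a ^ (1 / q) * a ^ (1 - 1 / q) = a := by
      rw [← Real.rpow_add' ha (by norm_num)]
      norm_num
    rw [Real.mul_rpow ha hv, Real.mul_rpow ha hy]
    linear_combination (-(v ^ (1 / q) * y ^ (1 - 1 / q))) * this
  rw [e3 a v y ha hv hy, e3 b v' y' hb hv' hy']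

/-- Joint convexity of `(g, y) ↦ g ^ q / y ^ (q - 1)`. -/
theorem quotPow_convex {q : ℝ} (hq : 1 < q) {a b g g₁ g₂ v₁ v₂ y₁ y₂ : ℝ} (ha : 0 ≤ a) (hb : 0 ≤ b)
    (hg : 0 ≤ g) (hg₁ : 0 ≤ g₁) (hg₂ : 0 ≤ g₂) (hy₁ : 0 ≤ y₁) (hy₂ : 0 ≤ y₂)
    (hle : g ≤ a * g₁ + b * g₂) (h₁ : quotPow q (g₁ ^ q) y₁ ≤ (v₁ : EReal))
    (h₂ : quotPow q (g₂ ^ q) y₂ ≤ (v₂ : EReal)) :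
    quotPow q (g ^ q) (a * y₁ + b * y₂) ≤ ((a * v₁ + b * v₂ : ℝ) : EReal) := by
  rw [quotPow_le_iff hq hg₁ hy₁] at h₁
  rw [quotPow_le_iff hq hg₂ hy₂] at h₂
  rw [quotPow_le_iff hq hg (by positivity)]
  refine ⟨add_nonneg (mul_nonneg ha h₁.1) (mul_nonneg hb h₂.1), hle.trans (le_trans ?_
    (geom_mean_concave hq ha hb h₁.1 h₂.1 hy₁ hy₂))⟩
  gcongr
  · exact h₁.2
  · exact h₂.2

theorem convexOn_inv_rpow {q : ℝ} (hq : 1 < q) :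
    ConvexOn ℝ (Set.Ioi 0) fun y : ℝ => 1 / y ^ (q - 1) := by
  refine ⟨convex_Ioi 0, fun y hy y' hy' a b ha hb hab => ?_⟩
  have hy0 : 0 < y := hy
  have hy0' : 0 < y' := hy'
  have hm : 0 < a * y + b * y' := (convex_Ioi (0 : ℝ)) hy hy' ha hb hab
  have key : ∀ y : ℝ, 0 < y → quotPow q (1 ^ q) y = ((1 / y ^ (q - 1) : ℝ) : EReal) := by
    intro y hy
    rw [quotPow, if_neg hy.ne', Real.one_rpow]
  have := quotPow_convex hq ha hb zero_le_one zero_le_one zero_le_one hy0.le hy0'.le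
    (by linarith : (1 : ℝ) ≤ a * 1 + b * 1) (key y hy0).le (key y' hy0').le
  rw [key _ hm, EReal.coe_le_coe_iff] at this
  exact this

/-- By homogeneity the perspective term is a power quotient with the exponent `r`, so the facts
about `quotPow` serve for it too. -/
theorem perspNormPow_eq_quotPow {F : Type*} [NormedAddCommGroup F] [NormedSpace ℝ F] {r : ℝ}
    (hr : 1 < r) (α : F) {w : ℝ} (hw : 0 ≤ w) :
    perspNormPow r α w = quotPow r (‖α‖ ^ r) w := by
  rw [perspNormPow, quotPow]
  split_ifs with h1 h2 h3 h3
  · rfl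
  · exact absurd (by rw [h2, norm_zero, Real.zero_rpow (by linarith)]) h3
  · exact absurd (norm_eq_zero.1 ((Real.rpow_eq_zero (norm_nonneg _) (by linarith)).1 h3)) h2
  · rfl
  · have hw0 : 0 < w := lt_of_le_of_ne hw (Ne.symm h1)
    congr 1
    rw [norm_smul, Real.norm_eq_abs, abs_of_pos (inv_pos.2 hw0),
      Real.mul_rpow (inv_pos.2 hw0).le (norm_nonneg _), Real.inv_rpow hw, Real.rpow_sub_one h1]
    field_simp

theorem quotPow_eq_top_or {q a y : ℝ} : quotPow q a y = ⊤ ∨ ∃ r : ℝ, quotPow q a y = r := by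
  rw [quotPow]
  split_ifs
  · exact Or.inr ⟨0, rfl⟩
  · exact Or.inl rfl
  · exact Or.inr ⟨_, rfl⟩

theorem constQOne_eq {q : ℝ} (hq : 1 < q) : constQOne q = q ^ (1 / (1 - q)) * (1 - 1 / q) := by
  have h1 : (1 : ℝ) - q ≠ 0 := by linarith
  have : q / (1 - q) = 1 / (1 - q) - 1 := by field_simp; ring
  rw [constQOne, this, Real.rpow_sub_one (by linarith)]
  ring

theorem constQOne_pos {q : ℝ} (hq : 1 < q) : 0 < constQOne q := by
  have hq0 : 0 < q := by linarith
  rw [constQOne_eq hq]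
  exact mul_pos (by positivity) (sub_pos.2 ((div_lt_one hq0).2 hq))

theorem constQ_eq (q C : ℝ) : constQ q C = C ^ (q / (q - 1)) * constQOne q := rfl

/-- Young's inequality in the normalization of `constQOne`. -/
theorem rpow_mul_rpow_le_add_constQOne {q x y : ℝ} (hq : 1 < q) (hx : 0 ≤ x) (hy : 0 ≤ y) :
    x ^ (1 / q) * y ^ (1 - 1 / q) ≤ x + constQOne q * y := by
  have hq0 : 0 < q := by linarith
  have hq1 : 0 < 1 - 1 / q := sub_pos.2 ((div_lt_one hq0).2 hq)
  have hκ : 0 < q ^ (1 / (1 - q)) := by positivity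
  -- The points are scaled so that the arithmetic mean is the right side and the scale factors
  -- cancel in the geometric mean.
  have := Real.geom_mean_le_arith_mean2_weighted (w₁ := 1 / q) (w₂ := 1 - 1 / q) (p₁ := q * x)
    (p₂ := q ^ (1 / (1 - q)) * y) (by positivity) hq1.le (by positivity) (by positivity) (by ring)
  rw [Real.mul_rpow hq0.le hx, Real.mul_rpow hκ.le hy, ← Real.rpow_mul hq0.le] at this
  have e : q ^ (1 / q) * q ^ (1 / (1 - q) * (1 - 1 / q)) = 1 := by
    rw [← Real.rpow_add hq0]
    have : 1 / q + 1 / (1 - q) * (1 - 1 / q) = 0 := by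
      have : 1 - q ≠ 0 := by linarith
      field_simp
      ring
    rw [this, Real.rpow_zero]
  rw [constQOne_eq hq]
  calc x ^ (1 / q) * y ^ (1 - 1 / q)
      = q ^ (1 / q) * x ^ (1 / q) *
          (q ^ (1 / (1 - q) * (1 - 1 / q)) * y ^ (1 - 1 / q)) := by
        linear_combination (-(x ^ (1 / q) * y ^ (1 - 1 / q))) * e
    _ ≤ _ := this
    _ = _ := by field_simp

/-- Equality case of `rpow_mul_rpow_le_add_constQOne`. -/
theorem div_rpow_add_constQOne_eq {q x : ℝ} (hq : 1 < q) (hx : 0 < x) :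
    x / (q ^ (1 / (q - 1)) * x ^ (1 / q)) ^ (q - 1) +
      constQOne q * (q ^ (1 / (q - 1)) * x ^ (1 / q)) = x ^ (1 / q) := by
  have hq0 : 0 < q := by linarith
  have hq1 : q - 1 ≠ 0 := by linarith
  have e1 : (q ^ (1 / (q - 1)) * x ^ (1 / q)) ^ (q - 1) = q * x ^ (1 - 1 / q) := by
    rw [Real.mul_rpow (by positivity) (by positivity), ← Real.rpow_mul hq0.le,
      ← Real.rpow_mul hx.le, one_div_mul_cancel hq1, Real.rpow_one]
    congr 2
    field_simp
  have e2 : q ^ (1 / (1 - q)) * q ^ (1 / (q - 1)) = 1 := by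
    rw [← Real.rpow_add hq0]
    have : 1 / (1 - q) + 1 / (q - 1) = 0 := by
      rw [← neg_sub q 1, div_neg, neg_add_cancel]
    rw [this, Real.rpow_zero]
  have e3 : x ^ (1 - 1 / q) * x ^ (1 / q) = x := by
    rw [← Real.rpow_add hx]; simp
  have hx1 : 0 < x ^ (1 - 1 / q) := by positivity
  have e4 : x / (q * x ^ (1 - 1 / q)) = 1 / q * x ^ (1 / q) := by
    rw [div_eq_iff (by positivity), show 1 / q * x ^ (1 / q) * (q * x ^ (1 - 1 / q)) =
      1 / q * q * (x ^ (1 - 1 / q) * x ^ (1 / q)) by ring, one_div_mul_cancel hq0.ne', one_mul, e3]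
  rw [e1, e4, constQOne_eq hq]
  linear_combination ((1 - 1 / q) * x ^ (1 / q)) * e2

/-- Duality for the concave function `(s, s') ↦ s ^ (1 / q) + s' ^ (1 / q)` on a convex set. -/
theorem exists_forall_div_rpow_add_le {q : ℝ} (hq : 1 < q) {D : Set (ℝ × ℝ)} (hD : Convex ℝ D)
    (hne : D.Nonempty) (hD0 : ∀ d ∈ D, 0 ≤ d.1 ∧ 0 ≤ d.2) {B ε : ℝ}
    (hB : ∀ d ∈ D, d.1 ^ (1 / q) + d.2 ^ (1 / q) ≤ B) (hε : 0 < ε) :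
    ∃ y y' : ℝ, 0 < y ∧ 0 < y' ∧ ∀ d ∈ D,
      d.1 / y ^ (q - 1) + constQOne q * y + (d.2 / y' ^ (q - 1) + constQOne q * y') ≤ B + ε := by
  have hq0 : 0 < q := by linarith
  obtain ⟨d₀, hd₀⟩ := hne
  -- The minimizer `κ s^(1/q)` vanishes at `s = 0`. Replacing `s` by `s + τ` keeps it in a compact
  -- interval of positive numbers and costs at most `τ^(1/q) = ε/3` per coordinate, in total less
  -- than `ε`.
  set τ : ℝ := (ε / 3) ^ q with hτ
  have hτ0 : 0 < τ := by positivity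
  have hτq : τ ^ (1 / q) = ε / 3 := by
    rw [hτ, ← Real.rpow_mul (by positivity), mul_one_div_cancel hq0.ne', Real.rpow_one]
  set κ : ℝ := q ^ (1 / (q - 1)) with hκ
  have hκ0 : 0 < κ := by positivity
  set I : Set ℝ := Set.Icc (κ * τ ^ (1 / q)) (κ * (B ^ q + τ) ^ (1 / q)) with hI
  have hI0 : ∀ y ∈ I, 0 < y := fun y hy => lt_of_lt_of_le (by positivity) hy.1
  have hopt : ∀ s : ℝ, 0 ≤ s → s ^ (1 / q) ≤ B → κ * (s + τ) ^ (1 / q) ∈ I := by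
    intro s hs hsB
    have hsB' : s ≤ B ^ q := by
      have := Real.rpow_le_rpow (by positivity) hsB hq0.le
      rwa [← Real.rpow_mul hs, one_div_mul_cancel hq0.ne', Real.rpow_one] at this
    constructor <;> gcongr
    linarith
  have hoptval : ∀ s : ℝ, 0 ≤ s → s / (κ * (s + τ) ^ (1 / q)) ^ (q - 1) +
      constQOne q * (κ * (s + τ) ^ (1 / q)) ≤ s ^ (1 / q) + ε / 3 := by
    intro s hs
    have h1 := div_rpow_add_constQOne_eq hq (show 0 < s + τ by positivity)
    rw [← hκ] at h1
    have h2 := Real.rpow_add_le_add_rpow hs hτ0.le (p := 1 / q) (by positivity)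
      ((div_le_one hq0).2 hq.le)
    rw [hτq] at h2
    refine le_trans ?_ (h1.le.trans h2)
    gcongr
    linarith
  by_contra! hno
  have hconvI : ConvexOn ℝ I fun y : ℝ => 1 / y ^ (q - 1) :=
    (convexOn_inv_rpow hq).subset (fun y hy => hI0 y hy) (convex_Icc _ _)
  have hconv1 : ∀ s : ℝ, 0 ≤ s → ConvexOn ℝ I fun y => s / y ^ (q - 1) + constQOne q * y := by
    intro s hs
    have h1 := (hconvI.smul hs).add ((convexOn_id (convex_Icc _ _)).smul (constQOne_pos hq).le)
    refine h1.congr fun y _ => ?_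
    simp [div_eq_mul_inv]
  have hcont1 : ∀ s : ℝ, ContinuousOn (fun y => s / y ^ (q - 1) + constQOne q * y) I := by
    intro s
    refine ContinuousOn.add (continuousOn_const.div
      (fun y hy => (Real.continuousAt_rpow_const _ _ (Or.inl (hI0 y hy).ne')).continuousWithinAt)
      fun y hy => (Real.rpow_pos_of_pos (hI0 y hy) _).ne') (by fun_prop)
  have hcontP : ∀ d : ℝ × ℝ, ContinuousOn (fun y : ℝ × ℝ => d.1 / y.1 ^ (q - 1) +
      constQOne q * y.1 + (d.2 / y.2 ^ (q - 1) + constQOne q * y.2)) (I ×ˢ I) := fun d =>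
    ((hcont1 d.1).comp continuousOn_fst fun y hy => hy.1).add
      ((hcont1 d.2).comp continuousOn_snd fun y hy => hy.2)
  have hcompact : IsCompact (I ×ˢ I) := isCompact_Icc.prod isCompact_Icc
  obtain ⟨d, hd, hle⟩ := exists_forall_le_of_concaveOn_convexOn (S := D) (D := I ×ˢ I)
    (f := fun d y => d.1 / y.1 ^ (q - 1) + constQOne q * y.1 +
      (d.2 / y.2 ^ (q - 1) + constQOne q * y.2)) (c := B + ε)
    (fun d hd => ⟨(convex_Icc _ _).prod (convex_Icc _ _), fun y hy y' hy' a b ha hb hab => by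
      have h1 := (hconv1 d.1 (hD0 d hd).1).2 hy.1 hy'.1 ha hb hab
      have h2 := (hconv1 d.2 (hD0 d hd).2).2 hy.2 hy'.2 ha hb hab
      refine (add_le_add h1 h2).trans (le_of_eq ?_)
      simp only [smul_eq_mul]
      ring⟩)
    (fun d _ => hcontP d)
    (fun y _ => ⟨hD, fun d _ d' _ a b _ _ hab => le_of_eq (by
      simp only [smul_eq_mul, Prod.fst_add, Prod.snd_add, Prod.smul_fst, Prod.smul_snd]
      linear_combination (constQOne q * y.1 + constQOne q * y.2) * hab)⟩)
    hd₀ (by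
      have := (hcontP d₀).preimage_isClosed_of_isClosed hcompact.isClosed (isClosed_Iic (a := B + ε))
      exact hcompact.of_isClosed_subset this Set.inter_subset_left)
    (fun y hy => by
      obtain ⟨d, hd, hlt⟩ := hno y.1 y.2 (hI0 _ hy.1) (hI0 _ hy.2)
      exact ⟨d, hd, hlt⟩)
  have hdB := hB d hd
  obtain ⟨h1, h2⟩ := hD0 d hd
  have h1q : 0 ≤ d.1 ^ (1 / q) := by positivity
  have h2q : 0 ≤ d.2 ^ (1 / q) := by positivity
  have := hle (κ * (d.1 + τ) ^ (1 / q), κ * (d.2 + τ) ^ (1 / q))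
    ⟨hopt _ h1 (by linarith), hopt _ h2 (by linarith)⟩
  have h3 := hoptval _ h1
  have h4 := hoptval _ h2
  simp only at this
  linarith

end Programs

/-! ### Equivalence with the convex programs -/

section Reformulation

theorem EReal.le_of_forall_real_le {x y : EReal} (h : ∀ c : ℝ, x ≤ c → y ≤ c) : y ≤ x :=
  EReal.le_of_forall_lt_iff_le.1 fun c hc => h c hc.le

/-- Reduces the joint program to the programs with `α` fixed. -/
theorem biInf_eq_biInf_fiber {X Y : Type*} {A : Set Y} {F : Set X} {π : X → Y} (obj : X → EReal)
    (h : ∀ x ∈ F, π x ∈ A) : ⨅ x ∈ F, obj x = ⨅ a ∈ A, ⨅ x ∈ {x ∈ F | π x = a}, obj x :=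
  le_antisymm (le_iInf₂ fun _ _ => le_iInf₂ fun x hx => iInf₂_le x hx.1)
    (le_iInf₂ fun x hx => (iInf₂_le (π x) (h x hx)).trans (iInf₂_le x ⟨hx, rfl⟩))

theorem indicatorConjugate_le_iff {N : ℕ} {S : Set ((Fin N → ℝ) × ℝ)} {v : (Fin N → ℝ) × ℝ} {c : ℝ} :
    indicatorConjugate S v ≤ c ↔ ∀ x ∈ S, ∑ i, v.1 i * x.1 i + v.2 * x.2 ≤ c := by
  simp only [indicatorConjugate, iSup_le_iff, EReal.coe_le_coe_iff]

variable {E : Type*} [NormedAddCommGroup E] [NormedSpace ℝ E] {N : ℕ}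
  {V : Set ((Fin N → ℝ) × ℝ)} {loss : ℝ → ℝ → ℝ} {yhat : Fin N → E} {A : Set (StrongDual ℝ E)}

theorem objOne_le_iff {α : StrongDual ℝ E} {t : ℝ} {v : Fin N → ℝ} {w c : ℝ} :
    objOne V (α, t, v, w) ≤ c ↔
      ∀ x ∈ nonnegRadius V, t + (∑ i, v i * x.1 i + w * x.2) ≤ c := by
  have h : objOne V (α, t, v, w) ≤ c ↔
      indicatorConjugate (nonnegRadius V) (v, w) ≤ ((c - t : ℝ) : EReal) := by
    rw [EReal.coe_sub, EReal.le_sub_iff_add_le (Or.inl (EReal.coe_ne_bot _))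
      (Or.inl (EReal.coe_ne_top _)), add_comm]
    rfl
  rw [h, indicatorConjugate_le_iff]
  exact forall₂_congr fun x _ => by constructor <;> intro h <;> linarith

/-- Since `p` and `δ` are nonnegative, enlarging `v` cannot help, and the best choice makes all
constraints tight. -/
theorem iInf_robustObjOne_eq {L : ℝ} (hVp : ∀ x ∈ V, x.1 ∈ stdSimplex ℝ (Fin N))
    {α : StrongDual ℝ E} (hα : α ∈ A) :
    ⨅ t : ℝ, robustObjOne loss L yhat V α t =
      ⨅ x ∈ {x ∈ feasOne A loss L yhat | x.1 = α}, objOne V x := by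
  refine le_antisymm (le_iInf₂ ?_) (le_iInf fun t => ?_)
  · rintro ⟨_, t, v, w⟩ ⟨⟨-, hv, hw⟩, rfl⟩
    refine (iInf_le _ t).trans (EReal.le_of_forall_real_le fun c hc => iSup₂_le fun x hx => ?_)
    refine EReal.coe_le_coe_iff.2 (le_trans ?_ (objOne_le_iff.1 hc x hx))
    have h1 := Finset.sum_le_sum fun i (_ : i ∈ Finset.univ) =>
      mul_le_mul_of_nonneg_left (hv i) ((hVp x hx.1).1 i)
    have h2 := mul_le_mul_of_nonneg_right hw hx.2
    simp only [mul_comm (v _)]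
    linarith
  · refine iInf₂_le_of_le (α, t, fun i => loss (α (yhat i)) t, L * ‖α‖)
      ⟨⟨hα, fun _ => le_rfl, le_rfl⟩, rfl⟩ (EReal.le_of_forall_real_le fun c hc => ?_)
    refine objOne_le_iff.2 fun x hx => ?_
    have := EReal.coe_le_coe_iff.1 ((le_iSup₂_of_le x hx le_rfl).trans hc)
    simp only [mul_comm (loss _ _)]
    linarith

theorem loss_combo_le (hconv : ConvexOn ℝ Set.univ fun x : ℝ × ℝ => loss x.1 x.2)
    (α α' : StrongDual ℝ E) (t t' : ℝ) (y : E) {a b : ℝ} (ha : 0 ≤ a) (hb : 0 ≤ b)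
    (hab : a + b = 1) :
    loss ((a • α + b • α') y) (a • t + b • t') ≤ a * loss (α y) t + b * loss (α' y) t' := by
  simpa using hconv.2 (Set.mem_univ (α y, t)) (Set.mem_univ (α' y, t')) ha hb hab

theorem norm_combo_le (α α' : StrongDual ℝ E) {a b : ℝ} (ha : 0 ≤ a) (hb : 0 ≤ b) :
    ‖a • α + b • α'‖ ≤ a * ‖α‖ + b * ‖α'‖ := by
  refine (norm_add_le _ _).trans (le_of_eq ?_)
  rw [norm_smul, norm_smul, Real.norm_of_nonneg ha, Real.norm_of_nonneg hb]

theorem isConvexProgram_one {L : ℝ} (hL : 0 ≤ L)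
    (hconv : ConvexOn ℝ Set.univ fun x : ℝ × ℝ => loss x.1 x.2) (hA : Convex ℝ A) :
    IsConvexProgram (feasOne A loss L yhat) (objOne V) := by
  have hfeas : Convex ℝ (feasOne A loss L yhat) := by
    rintro ⟨α, t, v, w⟩ ⟨hα, hv, hw⟩ ⟨α', t', v', w'⟩ ⟨hα', hv', hw'⟩ a b ha hb hab
    refine ⟨hA hα hα' ha hb hab, fun i => ?_, ?_⟩
    · refine (loss_combo_le hconv α α' t t' (yhat i) ha hb hab).trans ?_
      exact add_le_add (mul_le_mul_of_nonneg_left (hv i) ha) (mul_le_mul_of_nonneg_left (hv' i) hb)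
    · refine (mul_le_mul_of_nonneg_left (norm_combo_le α α' ha hb) hL).trans ?_
      have h1 := mul_le_mul_of_nonneg_left hw ha
      have h2 := mul_le_mul_of_nonneg_left hw' hb
      change _ ≤ a * w + b * w'
      linarith
  refine ⟨hfeas, ?_⟩
  rintro ⟨⟨α, t, v, w⟩, c⟩ ⟨hf, hc⟩ ⟨⟨α', t', v', w'⟩, c'⟩ ⟨hf', hc'⟩ a b ha hb hab
  refine ⟨hfeas hf hf' ha hb hab, objOne_le_iff.2 fun x hx => ?_⟩
  have h1 := mul_le_mul_of_nonneg_left (objOne_le_iff.1 hc x hx) ha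
  have h2 := mul_le_mul_of_nonneg_left (objOne_le_iff.1 hc' x hx) hb
  simp only [Prod.smul_mk, Prod.mk_add_mk, Pi.add_apply, Pi.smul_apply, smul_eq_mul, add_mul,
    Finset.sum_add_distrib, mul_assoc, ← Finset.mul_sum] at h1 h2 ⊢
  linarith

variable {q C : ℝ}

theorem one_lt_conj (hq : 1 < q) : 1 < q / (q - 1) := by
  rw [lt_div_iff₀ (by linarith)]
  linarith

theorem one_div_conj (hq : 1 < q) : 1 / (q / (q - 1)) = 1 - 1 / q := by
  have : q - 1 ≠ 0 := by linarith
  field_simp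

theorem constQ_pos (hq : 1 < q) (hC : 0 < C) : 0 < constQ q C := by
  rw [constQ_eq]
  exact mul_pos (by positivity) (constQOne_pos hq)

/-- Replaces extended-real arithmetic by real inequalities, with `r` an epigraph variable for the
perspective term. Nonemptiness of `V₊` keeps the support function above `⊥`, so that an infinite
perspective term is not absorbed. -/
theorem objQ_le_iff (hq : 1 < q) (hC : 0 < C) (hne : (nonnegRadius V).Nonempty)
    {α : StrongDual ℝ E} {t y : ℝ} {v : Fin N → ℝ} {w c : ℝ} (hw : 0 ≤ w) :
    objQ q C V (α, t, y, v, w) ≤ c ↔ ∃ r : ℝ,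
      quotPow (q / (q - 1)) (‖α‖ ^ (q / (q - 1))) w ≤ (r : EReal) ∧ ∀ x ∈ nonnegRadius V,
        t + (∑ i, v i * x.1 i + w * x.2) + constQOne q * y + constQ q C * r ≤ c := by
  have hcq := constQ_pos hq hC
  have hobj : objQ q C V (α, t, y, v, w) = objOne V (α, t, v, w) + ((constQOne q * y : ℝ) : EReal) +
      (constQ q C : EReal) * quotPow (q / (q - 1)) (‖α‖ ^ (q / (q - 1))) w := by
    rw [← perspNormPow_eq_quotPow (one_lt_conj hq) α hw]
    rfl
  have key : ∀ r : ℝ, objOne V (α, t, v, w) + ((constQOne q * y : ℝ) : EReal) +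
      (constQ q C : EReal) * (r : EReal) ≤ c ↔ ∀ x ∈ nonnegRadius V,
        t + (∑ i, v i * x.1 i + w * x.2) + constQOne q * y + constQ q C * r ≤ c := by
    intro r
    have : objOne V (α, t, v, w) + ((constQOne q * y : ℝ) : EReal) +
        (constQ q C : EReal) * (r : EReal) ≤ c ↔
        objOne V (α, t, v, w) ≤ ((c - (constQOne q * y + constQ q C * r) : ℝ) : EReal) := by
      rw [EReal.coe_sub, EReal.le_sub_iff_add_le (Or.inl (EReal.coe_ne_bot _))
        (Or.inl (EReal.coe_ne_top _)), EReal.coe_add, EReal.coe_mul (constQ q C),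
        ← add_assoc]
    rw [this, objOne_le_iff]
    exact forall₂_congr fun x _ => by constructor <;> intro h <;> linarith
  rw [hobj]
  constructor
  · intro h
    rcases quotPow_eq_top_or (q := q / (q - 1)) (a := ‖α‖ ^ (q / (q - 1))) (y := w) with hr | ⟨r, hr⟩
    · exfalso
      obtain ⟨x, hx⟩ := hne
      have hbot : objOne V (α, t, v, w) + ((constQOne q * y : ℝ) : EReal) ≠ ⊥ := by
        rw [Ne, EReal.add_eq_bot_iff, not_or]
        refine ⟨fun hb => ?_, EReal.coe_ne_bot _⟩
        have := objOne_le_iff.1 (hb.trans_le (bot_le (a :=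
          ((t + (∑ i, v i * x.1 i + w * x.2) - 1 : ℝ) : EReal)))) x hx
        linarith
      rw [hr, EReal.coe_mul_top_of_pos hcq, EReal.add_top_of_ne_bot hbot, top_le_iff] at h
      exact EReal.coe_ne_top _ h
    · exact ⟨r, hr.le, (key r).1 (by rwa [hr] at h)⟩
  · rintro ⟨r, hr, h⟩
    rcases quotPow_eq_top_or (q := q / (q - 1)) (a := ‖α‖ ^ (q / (q - 1))) (y := w) with hr' | ⟨s, hs⟩
    · rw [hr', top_le_iff] at hr
      exact absurd hr (EReal.coe_ne_top _)
    · rw [hs, EReal.coe_le_coe_iff] at hr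
      rw [hs]
      refine (key s).2 fun x hx => le_trans ?_ (h x hx)
      have := mul_le_mul_of_nonneg_left hr hcq.le
      linarith

/-- Young's inequality at `w δ` and `C^(q/(q-1)) r`: the constraint bounds `n` by the geometric mean
of `w` and `r` with weights `1/q` and `1 - 1/q`. -/
theorem mul_rpow_mul_le_of_quotPow_le (hq : 1 < q) (hC : 0 < C) {δ w n r : ℝ} (hδ : 0 ≤ δ)
    (hw : 0 ≤ w) (hn : 0 ≤ n)
    (h : quotPow (q / (q - 1)) (n ^ (q / (q - 1))) w ≤ (r : EReal)) :
    C * δ ^ (1 / q) * n ≤ w * δ + constQ q C * r := by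
  have hq0 : 0 < q := by linarith
  rw [quotPow_le_iff (one_lt_conj hq) hn hw, one_div_conj hq, sub_sub_cancel] at h
  have h1 := rpow_mul_rpow_le_add_constQOne hq (mul_nonneg hw hδ)
    (mul_nonneg (Real.rpow_nonneg hC.le (q / (q - 1))) h.1)
  rw [Real.mul_rpow hw hδ, Real.mul_rpow (by positivity) h.1, ← Real.rpow_mul hC.le,
    ← one_div_conj hq, mul_one_div_cancel (by linarith [one_lt_conj hq]), Real.rpow_one,
    one_div_conj hq] at h1
  have h2 := mul_le_mul_of_nonneg_left h.2 (show 0 ≤ C * δ ^ (1 / q) by positivity)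
  rw [constQ_eq]
  linarith

/-- The constraints say `g i ^ q ≤ v i * y ^ (q - 1)`; averaging over `p` and taking roots leaves a
geometric mean, to which Young's inequality applies. -/
theorem rpow_sum_le_of_quotPow_le (hq : 1 < q) {p g v : Fin N → ℝ} {y : ℝ} (hp : ∀ i, 0 ≤ p i)
    (hg : ∀ i, 0 ≤ g i) (hy : 0 ≤ y) (h : ∀ i, quotPow q (g i ^ q) y ≤ ((v i : ℝ) : EReal)) :
    (∑ i, p i * g i ^ q) ^ (1 / q) ≤ ∑ i, v i * p i + constQOne q * y := by
  have hq0 : 0 < q := by linarith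
  simp only [quotPow_le_iff hq (hg _) hy] at h
  have hsum0 : 0 ≤ ∑ i, v i * p i := Finset.sum_nonneg fun i _ => mul_nonneg (h i).1 (hp i)
  refine le_trans ?_ (rpow_mul_rpow_le_add_constQOne hq hsum0 hy)
  have e : ∀ v : ℝ, 0 ≤ v → (v ^ (1 / q) * y ^ (1 - 1 / q)) ^ q = v * y ^ (q - 1) := by
    intro v hv
    rw [Real.mul_rpow (by positivity) (by positivity), ← Real.rpow_mul hv, ← Real.rpow_mul hy,
      one_div_mul_cancel hq0.ne', Real.rpow_one, sub_mul, one_div_mul_cancel hq0.ne', one_mul]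
  rw [one_div, Real.rpow_inv_le_iff_of_pos (Finset.sum_nonneg fun i _ =>
    mul_nonneg (hp i) (Real.rpow_nonneg (hg i) _)) (by positivity) hq0, ← one_div, e _ hsum0,
    Finset.sum_mul]
  refine Finset.sum_le_sum fun i _ => ?_
  have := Real.rpow_le_rpow (hg i) (h i).2 hq0.le
  rw [e _ (h i).1] at this
  have := mul_le_mul_of_nonneg_left this (hp i)
  linarith

theorem iInf_robustObjQ_eq (hq : 1 < q) (hC : 0 < C) (hl : ∀ z t, 0 ≤ loss z t) (hV : Convex ℝ V)
    (hVp : ∀ x ∈ V, x.1 ∈ stdSimplex ℝ (Fin N)) {α : StrongDual ℝ E} (hα : α ∈ A) :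
    ⨅ t : ℝ, robustObjQ q loss C yhat V α t =
      ⨅ x ∈ {x ∈ feasQ A q loss yhat | x.1 = α}, objQ q C V x := by
  have hq0 : 0 < q := by linarith
  rcases (nonnegRadius V).eq_empty_or_nonempty with hemp | hne
  · have h1 : ∀ t, robustObjQ q loss C yhat V α t = ⊥ := fun t => by simp [robustObjQ, hemp]
    have h2 : ∀ x, objQ (E := E) q C V x = ⊥ := fun x => by
      simp [objQ, indicatorConjugate, hemp]
    simp only [h1, h2, iInf_const]
    -- Both objectives are identically `⊥`, but the program also needs a feasible point, lest its
    -- infimum be `⊤`.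
    refine (le_bot_iff.1 (iInf₂_le (α, 0, 1, fun i => loss (α (yhat i)) 0 ^ q, 0)
      ⟨⟨hα, zero_le_one, fun i => ?_, le_rfl⟩, rfl⟩)).symm
    simp [quotPow]
  refine le_antisymm (le_iInf₂ ?_) (le_iInf fun t => ?_)
  · rintro ⟨_, t, y, v, w⟩ ⟨⟨-, hy, hv, hw⟩, rfl⟩
    refine (iInf_le _ t).trans (EReal.le_of_forall_real_le fun c hc => iSup₂_le fun x hx => ?_)
    obtain ⟨r, hr, h⟩ := (objQ_le_iff hq hC hne hw).1 hc
    refine EReal.coe_le_coe_iff.2 (le_trans ?_ (h x hx))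
    have h1 := mul_rpow_mul_le_of_quotPow_le hq hC hx.2 hw (norm_nonneg _) hr
    have h2 := rpow_sum_le_of_quotPow_le hq (hVp x hx.1).1 (fun i => hl _ _) hy hv
    linarith
  · refine EReal.le_of_forall_lt_iff_le.1 fun c hc => ?_
    obtain ⟨b, hb, hbc⟩ := EReal.lt_iff_exists_real_btwn.1 hc
    have hbc := EReal.coe_lt_coe_iff.1 hbc
    have hS : ∀ x ∈ nonnegRadius V, t + (∑ i, x.1 i * loss (α (yhat i)) t ^ q) ^ (1 / q) +
        C * x.2 ^ (1 / q) * ‖α‖ ≤ b := fun x hx =>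
      EReal.coe_le_coe_iff.1 ((le_iSup₂_of_le x hx le_rfl).trans hb.le)
    -- The linear image of `V₊` formed by the two radicands: the factor `(C ‖α‖)^q` makes the `q`-th
    -- root of the second coordinate equal to `C δ^(1/q) ‖α‖`.
    set D : Set (ℝ × ℝ) := (fun x : (Fin N → ℝ) × ℝ =>
      (∑ i, x.1 i * loss (α (yhat i)) t ^ q, x.2 * (C * ‖α‖) ^ q)) '' nonnegRadius V with hD
    have hVc : Convex ℝ (nonnegRadius V) :=
      fun x hx x' hx' a b ha hb hab => ⟨hV hx.1 hx'.1 ha hb hab,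
        add_nonneg (mul_nonneg ha hx.2) (mul_nonneg hb hx'.2)⟩
    have hDc : Convex ℝ D := by
      refine hVc.is_linear_image ⟨fun x x' => ?_, fun a x => ?_⟩
      · simp [add_mul, Finset.sum_add_distrib]
      · simp [mul_assoc, Finset.mul_sum]
    have hsq : ∀ x ∈ nonnegRadius V, (x.2 * (C * ‖α‖) ^ q) ^ (1 / q) = C * x.2 ^ (1 / q) * ‖α‖ := by
      intro x hx
      rw [Real.mul_rpow hx.2 (by positivity), ← Real.rpow_mul (by positivity),
        mul_one_div_cancel hq0.ne', Real.rpow_one]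
      ring
    obtain ⟨y, y', hy, hy', hle⟩ := exists_forall_div_rpow_add_le hq hDc (hne.image _)
      (by
        rintro _ ⟨x, hx, rfl⟩
        refine ⟨?_, mul_nonneg hx.2 (by positivity)⟩
        dsimp only
        exact Finset.sum_nonneg fun i _ => mul_nonneg ((hVp x hx.1).1 i)
          (Real.rpow_nonneg (hl _ _) _))
      (B := b - t) (by
        rintro _ ⟨x, hx, rfl⟩
        simp only [hsq x hx]
        linarith [hS x hx]) (sub_pos.2 hbc)
    have hw0 : 0 ≤ (C * ‖α‖) ^ q / y' ^ (q - 1) := by positivity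
    -- Here `v` and `w` are the coefficients of `p` and `δ` in the dual bound. The perspective term
    -- is then at most `y' / C^(q/(q-1))`, with inequality to spare when `α = 0`, and `C_q` times
    -- this is `C_q¹ y'`.
    refine iInf₂_le_of_le (α, t, y, fun i => loss (α (yhat i)) t ^ q / y ^ (q - 1),
      (C * ‖α‖) ^ q / y' ^ (q - 1)) ⟨⟨hα, hy.le, fun i => ?_, hw0⟩, rfl⟩
      ((objQ_le_iff hq hC hne hw0).2 ⟨y' / C ^ (q / (q - 1)), ?_, fun x hx => ?_⟩)
    · rw [quotPow, if_neg hy.ne']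
    · rw [quotPow_le_iff (one_lt_conj hq) (norm_nonneg _) hw0, one_div_conj hq, sub_sub_cancel]
      refine ⟨by positivity, le_of_eq ?_⟩
      rw [Real.div_rpow hy'.le (by positivity), Real.div_rpow (by positivity) (by positivity),
        ← one_div_conj hq, ← Real.rpow_mul hC.le, mul_one_div_cancel
          (by linarith [one_lt_conj hq]), Real.rpow_one, one_div_conj hq,
        ← Real.rpow_mul (by positivity), mul_one_div_cancel hq0.ne', Real.rpow_one,
        ← Real.rpow_mul hy'.le]
      have : (q - 1) * (1 / q) = 1 - 1 / q := by field_simp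
      rw [this]
      field_simp
    · have := hle _ ⟨x, hx, rfl⟩
      simp only at this
      have e1 : ∑ i, loss (α (yhat i)) t ^ q / y ^ (q - 1) * x.1 i =
          (∑ i, x.1 i * loss (α (yhat i)) t ^ q) / y ^ (q - 1) := by
        rw [Finset.sum_div]
        exact Finset.sum_congr rfl fun i _ => by ring
      have e2 : constQ q C * (y' / C ^ (q / (q - 1))) = constQOne q * y' := by
        rw [constQ_eq]
        field_simp
      have e3 : (C * ‖α‖) ^ q / y' ^ (q - 1) * x.2 = x.2 * (C * ‖α‖) ^ q / y' ^ (q - 1) := by ring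
      rw [e1, e2, e3]
      linarith

/-- Joint convexity of the power quotient is used twice: with exponent `q` for the constraints on
`v`, and with the conjugate exponent for the perspective term. -/
theorem isConvexProgram_q (hq : 1 < q) (hC : 0 < C) (hl : ∀ z t, 0 ≤ loss z t)
    (hconv : ConvexOn ℝ Set.univ fun x : ℝ × ℝ => loss x.1 x.2) (hA : Convex ℝ A) :
    IsConvexProgram (feasQ A q loss yhat) (objQ q C V) := by
  have hfeas : Convex ℝ (feasQ A q loss yhat) := by
    rintro ⟨α, t, y, v, w⟩ ⟨hα, hy, hv, hw⟩ ⟨α', t', y', v', w'⟩ ⟨hα', hy', hv', hw'⟩ a b ha hb hab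
    refine ⟨hA hα hα' ha hb hab, add_nonneg (mul_nonneg ha hy) (mul_nonneg hb hy'), fun i => ?_,
      add_nonneg (mul_nonneg ha hw) (mul_nonneg hb hw')⟩
    exact quotPow_convex hq ha hb (hl _ _) (hl _ _) (hl _ _) hy hy'
      (loss_combo_le hconv α α' t t' (yhat i) ha hb hab) (hv i) (hv' i)
  refine ⟨hfeas, ?_⟩
  rintro ⟨⟨α, t, y, v, w⟩, c⟩ ⟨hf, hc⟩ ⟨⟨α', t', y', v', w'⟩, c'⟩ ⟨hf', hc'⟩ a b ha hb hab
  refine ⟨hfeas hf hf' ha hb hab, ?_⟩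
  rcases (nonnegRadius V).eq_empty_or_nonempty with hemp | hne
  · refine le_of_eq_of_le ?_ bot_le
    simp [objQ, indicatorConjugate, hemp]
  have hw : 0 ≤ w := hf.2.2.2
  have hw' : 0 ≤ w' := hf'.2.2.2
  obtain ⟨r, hr, h⟩ := (objQ_le_iff hq hC hne hw).1 hc
  obtain ⟨r', hr', h'⟩ := (objQ_le_iff hq hC hne hw').1 hc'
  refine (objQ_le_iff hq hC hne (add_nonneg (mul_nonneg ha hw) (mul_nonneg hb hw'))).2
    ⟨a * r + b * r', quotPow_convex (one_lt_conj hq) ha hb (norm_nonneg _) (norm_nonneg _)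
      (norm_nonneg _) hw hw' (norm_combo_le α α' ha hb) hr hr', fun x hx => ?_⟩
  have h1 := mul_le_mul_of_nonneg_left (h x hx) ha
  have h2 := mul_le_mul_of_nonneg_left (h' x hx) hb
  simp only [Prod.smul_mk, Prod.mk_add_mk, Pi.add_apply, Pi.smul_apply, smul_eq_mul, add_mul,
    Finset.sum_add_distrib, mul_assoc, ← Finset.mul_sum] at h1 h2 ⊢
  linarith

theorem robustObjOne_eq_robustObjQ (L : ℝ) (α : StrongDual ℝ E) (t : ℝ) :
    robustObjOne loss L yhat V α t = robustObjQ 1 loss L yhat V α t := by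
  simp [robustObjOne, robustObjQ]

end Reformulation

theorem mainTheorem8
    {E : Type*} [NormedAddCommGroup E] [NormedSpace ℝ E] [FiniteDimensional ℝ E]
    [MeasurableSpace E] [BorelSpace E]
    {N : ℕ} (yhat : Fin N → E)
    (V : Set ((Fin N → ℝ) × ℝ)) (hV : Convex ℝ V) (hVp : ∀ x ∈ V, x.1 ∈ stdSimplex ℝ (Fin N))
    (A : Set (StrongDual ℝ E)) :
    (∀ (loss : ℝ → ℝ → ℝ) (L : ℝ≥0),
      (∀ z t, 0 ≤ loss z t) →
      ConvexOn ℝ Set.univ (fun x : ℝ × ℝ => loss x.1 x.2) →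
      IsLeast {K : ℝ≥0 | ∀ t, LipschitzWith K (fun z => loss z t)} L →
      (∀ z a : ℝ, Bornology.IsBounded {t : ℝ | t + loss z t ≤ a}) →
        (⨅ α ∈ A, worstCaseRisk 1 loss yhat V α)
            = (⨅ α ∈ A, ⨅ t : ℝ, robustObjOne loss L yhat V α t) ∧
        (⨅ α ∈ A, worstCaseRisk 1 loss yhat V α)
            = (⨅ x ∈ feasOne A loss L yhat, objOne V x) ∧
        (∀ α ∈ A,
          worstCaseRisk 1 loss yhat V α = (⨅ t : ℝ, robustObjOne loss L yhat V α t) ∧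
          worstCaseRisk 1 loss yhat V α
            = (⨅ x ∈ {x ∈ feasOne A loss L yhat | x.1 = α}, objOne V x)) ∧
        (Convex ℝ A →
          IsConvexProgram (feasOne A loss L yhat) (objOne V))) ∧
    (∀ (q C : ℝ) (loss : ℝ → ℝ → ℝ),
      1 < q → 1 < C → IsSpecialLoss C loss →
        (⨅ α ∈ A, worstCaseRisk q loss yhat V α)
            = (⨅ α ∈ A, ⨅ t : ℝ, robustObjQ q loss C yhat V α t) ∧
        (⨅ α ∈ A, worstCaseRisk q loss yhat V α)
            = (⨅ x ∈ feasQ A q loss yhat, objQ q C V x) ∧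
        (∀ α ∈ A,
          worstCaseRisk q loss yhat V α = (⨅ t : ℝ, robustObjQ q loss C yhat V α t) ∧
          worstCaseRisk q loss yhat V α
            = (⨅ x ∈ {x ∈ feasQ A q loss yhat | x.1 = α}, objQ q C V x)) ∧
        (Convex ℝ A →
          IsConvexProgram (feasQ A q loss yhat) (objQ q C V))) := by
  refine ⟨fun loss L hl hconv hL hbdd => ?_, fun q C loss hq hC hloss => ?_⟩
  · have h1 : ∀ α, worstCaseRisk 1 loss yhat V α = ⨅ t : ℝ, robustObjOne loss L yhat V α t := by
      intro α
      simp only [robustObjOne_eq_robustObjQ]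
      exact worstCaseRisk_eq_iInf_robustObjQ le_rfl hl hconv hL.1 hbdd (reaches_one hl hconv hL)
        yhat hV hVp α
    have h2 : ∀ α ∈ A, worstCaseRisk 1 loss yhat V α =
        ⨅ x ∈ {x ∈ feasOne A loss L yhat | x.1 = α}, objOne V x := fun α hα =>
      (h1 α).trans (iInf_robustObjOne_eq hVp hα)
    refine ⟨biInf_congr fun α _ => h1 α, ?_, fun α hα => ⟨h1 α, h2 α hα⟩,
      isConvexProgram_one L.2 hconv⟩
    rw [biInf_eq_biInf_fiber (A := A) (π := Prod.fst) _ fun x hx => hx.1]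
    exact biInf_congr h2
  · have hC0 : 0 < C := by linarith
    have hl := hloss.nonneg hC
    have hconv := hloss.convexOn hC
    have hcoe : ((C.toNNReal : ℝ≥0) : ℝ) = C := Real.coe_toNNReal C hC0.le
    have h1 : ∀ α, worstCaseRisk q loss yhat V α = ⨅ t : ℝ, robustObjQ q loss C yhat V α t := by
      intro α
      have := worstCaseRisk_eq_iInf_robustObjQ hq.le hl hconv (hloss.lipschitzWith hC)
        (hloss.isBounded hC) (by rw [hcoe]; exact hloss.reaches hC hq) yhat hV hVp α
      rwa [hcoe] at this
    have h2 : ∀ α ∈ A, worstCaseRisk q loss yhat V α =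
        ⨅ x ∈ {x ∈ feasQ A q loss yhat | x.1 = α}, objQ q C V x := fun α hα =>
      (h1 α).trans (iInf_robustObjQ_eq hq hC0 hl hV hVp hα)
    refine ⟨biInf_congr fun α _ => h1 α, ?_, fun α hα => ⟨h1 α, h2 α hα⟩,
      isConvexProgram_q hq hC0 hl hconv⟩
    rw [biInf_eq_biInf_fiber (A := A) (π := Prod.fst) _ fun x hx => hx.1]
    exact biInf_congr h2
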